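/- **Setting.** Operators act on finite dimensional complex Hilbert spaces; an observable is a Hermitian operator, and repeated upper/lower indices are summed. For positive operators $\rho,\sigma$ let $\operatorname{supp}\rho=(\ker\rho)^\perp$, let $\iota_\rho:\operatorname{supp}\rho\hookrightarrow\mathcal H$ be the inclusion, and let $\sigma|_\rho:=\iota_\rho^*\sigma\iota_\rho$. Write $\rho\ll\sigma$ (or $\sigma\gg\rho$) if $\sigma|_\rho>0$, and $\rho\perp\sigma$ if $\sigma|_\rho=0$. The quantum Lebesgue decomposition of $\sigma$ with respect to $\rho$ is $\sigma=\sigma^a+\sigma^\perp$ with $\sigma^a,\sigma^\perp\ge 0$, $\sigma^a\ll\rho$, $\sigma^\perp\perp\rho$. If $\rho\ll\sigma$, (a version of) the quantum log-likelihood ratio $\mathcal L(\sigma|\rho)$ is a Hermitian operator $\mathcal L$ with $\sigma^a=e^{\mathcal L/2}\rho\,e^{\mathcal L/2}$; by convention $\mathcal L(\rho|\rho)=0$. For $h\in\mathbb R^m$ and a Hermitian positive semidefinite $m\times m$ matrix $J$, observables $X^{(n)}=(X^{(n)}_1,\dots,X^{(n)}_m)$ and states $\rho^{(n)}$ on $\mathcal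 H^{(n)}$ satisfy $X^{(n)}\xrightarrow{\rho^{(n)}}N(h,J)$ if for every finite sequence $\xi_1,\dots,\xi_s\in\mathbb C^m$ $$\lim_{n\to\infty}\operatorname{Tr}\rho^{(n)}\prod_{t=1}^{s}e^{\sqrt{-1}\,\xi_t^iX_i^{(n)}}=\exp\Big(\sum_{t=1}^s\big(\sqrt{-1}\,\xi_t^ih_i-\tfrac12\xi_t^i\xi_t^jJ_{ji}\big)-\sum_{t<u}\xi_t^i\xi_u^jJ_{ji}\Big)$$ (ordered product), the right-hand side being the quasi-characteristic function of the quantum Gaussian state $N(h,J)$. If $X^{(n)}\xrightarrow{\rho^{(n)}}N(0,J)$, a sequence $R^{(n)}$ of observables is $o(X^{(n)},\rho^{(n)})$ if for all $\xi_t\in\mathbb C^m$, $\eta_t\in\mathbb C$ the limit of $\operatorname{Tr}\rho^{(n)}\prod_te^{\sqrt{-1}(\xi_t^iX_i^{(n)}+\eta_tR^{(n)})}$ is that same expression with $h=0$. Let $\Theta\subset\mathbb R^d$ be open, $\theta_0\in\Theta$. A sequence of models $\{\rho^{(n)}_\theta\}_{\theta\in\Theta}$ of density operators, together with observables $X^{(n)}=(X_1^{(n)},\dots,X_r^{(n)})$,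 is *jointly q-LAN* at $\theta_0$ if (i) $\rho^{(n)}_\theta\gg\rho^{(n)}_{\theta_0}$ for all $\theta\in\Theta$, $n\ge1$; (ii) there are observables $\Delta^{(n)}=(\Delta_1^{(n)},\dots,\Delta_d^{(n)})$ with $$\begin{pmatrix}X^{(n)}\\ \Delta^{(n)}\end{pmatrix}\xrightarrow{\rho^{(n)}_{\theta_0}}N\left(\begin{pmatrix}0\\0\end{pmatrix},\begin{pmatrix}\Sigma&\tau\\ \tau^*&J\end{pmatrix}\right),$$ where $\Sigma,J$ are Hermitian positive semidefinite, $\tau$ is a complex $r\times d$ matrix and $\operatorname{Re}J>0$; (iii) for every $h\in\mathbb R^d$, a version of $\mathcal L_h^{(n)}=\mathcal L(\rho^{(n)}_{\theta_0+h/\sqrt n}|\rho^{(n)}_{\theta_0})$ satisfies $\mathcal L^{(n)}_h=h^i\Delta_i^{(n)}-\tfrac12(J_{ij}h^ih^j)I^{(n)}+o\big((X^{(n)},\Delta^{(n)}),\rho^{(n)}_{\theta_0}\big)$. **Statement.** Let $\{\rho_\theta\mid\theta\in\Theta\}$, with $\Theta\subset\mathbb R^d$ open, be a family of density operators on a finite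 dimensional Hilbert space $\mathcal H$, and let $\theta_0\in\Theta$ be such that $\rho_\theta\gg\rho_{\theta_0}$ for all $\theta\in\Theta$. Let $B_1,\dots,B_r$ be observables on $\mathcal H$ with $\operatorname{Tr}\rho_{\theta_0}B_i=0$. Suppose that (a version of) $\mathcal L_h:=\mathcal L(\rho_{\theta_0+h}|\rho_{\theta_0})$, with $\mathcal L_0=0$, is differentiable at $h=0$ and that $\operatorname{Tr}\rho_{\theta_0}e^{\mathcal L_h}=1-o(\|h\|^2)$ as $h\to0$. Then symmetric logarithmic derivatives at $\theta_0$ exist, i.e. there are Hermitian $L_1,\dots,L_d$ with $\partial_i\rho_\theta|_{\theta=\theta_0}=\frac12(\rho_{\theta_0}L_i+L_i\rho_{\theta_0})$. For any such $L_1,\dots,L_d$ put $$\Sigma_{ij}=\operatorname{Tr}\rho_{\theta_0}B_jB_i,\qquad \tau_{ij}=\operatorname{Tr}\rho_{\theta_0}L_jB_i,\qquad J_{ij}=\operatorname{Tr}\rho_{\theta_0}L_jL_i,$$ $$X_i^{(n)}=\frac1{\sqrt n}\sum_{k=1}^nI^{\otimes(k-1)}\otimes B_i\otimes I^{\otimes(n-k)},\qquad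 \Delta_i^{(n)}=\frac1{\sqrt n}\sum_{k=1}^nI^{\otimes(k-1)}\otimes L_i\otimes I^{\otimes(n-k)}.$$ (a) If $\operatorname{Re}J>0$ (equivalently, the derivatives $\partial_i\rho_\theta|_{\theta=\theta_0}$ are linearly independent over $\mathbb R$), then $(\{\rho_\theta^{\otimes n}\},X^{(n)})$ is jointly q-LAN at $\theta_0$, with these $\Delta^{(n)},\Sigma,\tau,J$. (b) For every $h\in\mathbb R^d$ (whether or not $\operatorname{Re}J>0$), $X^{(n)}\xrightarrow{\rho_{\theta_0+h/\sqrt n}^{\otimes n}}N((\operatorname{Re}\tau)h,\Sigma)$. -/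

import Mathlib

open Filter Topology
open scoped Matrix ComplexOrder

noncomputable section

namespace QLAN

/-- The parameter space `ℝ^d` with its Euclidean norm. -/
abbrev Param (d : ℕ) : Type := EuclideanSpace ℝ (Fin d)

section Operators

variable {ι : Type*} [Fintype ι] [DecidableEq ι]

/-- Operators on the finite dimensional Hilbert space `ℂ^ι` are complex `ι × ι` matrices.
A density operator is a positive semidefinite operator of trace one. -/
structure IsDensity (ρ : Matrix ι ι ℂ) : Prop where
  posSemidef : ρ.PosSemidef
  trace_eq_one : ρ.trace = 1

/-- `supp ρ = (ker ρ)ᗮ`. -/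
def supp (ρ : Matrix ι ι ℂ) : Submodule ℂ (EuclideanSpace ℂ ι) :=
  (LinearMap.ker (Matrix.toEuclideanLin ρ))ᗮ

/-- The excision `ι_ρ^* σ ι_ρ` of `σ` relative to `ρ`, an operator on `supp ρ`, where
`ι_ρ : supp ρ → ℂ^ι` is the inclusion. -/
def excision (σ ρ : Matrix ι ι ℂ) : supp ρ →ₗ[ℂ] supp ρ :=
  LinearMap.adjoint (𝕜 := ℂ) (E := supp ρ) (F := EuclideanSpace ℂ ι) (supp ρ).subtype ∘ₗ
    Matrix.toEuclideanLin σ ∘ₗ (supp ρ).subtype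

/-- `ρ ⟂ σ`: the excision of `σ` relative to `ρ` vanishes. -/
def Singular (ρ σ : Matrix ι ι ℂ) : Prop := excision σ ρ = 0

/-- `ρ ≪ σ` (that is, `σ ≫ ρ`): the excision of `σ` relative to `ρ` is strictly positive. -/
def AbsCont (ρ σ : Matrix ι ι ℂ) : Prop :=
  LinearMap.IsSymmetric (𝕜 := ℂ) (E := supp ρ) (excision σ ρ) ∧
    ∀ x : supp ρ, x ≠ 0 → 0 < (inner ℂ x (excision σ ρ x)).re

/-- `σ = σa + σs` is the quantum Lebesgue decomposition of `σ` with respect to `ρ`: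
`σa, σs ≥ 0`, `σa ≪ ρ` and `σs ⟂ ρ`. -/
structure IsLebesgueDecomp (σ ρ σa σs : Matrix ι ι ℂ) : Prop where
  eq_add : σ = σa + σs
  posSemidef_ac : σa.PosSemidef
  posSemidef_sing : σs.PosSemidef
  absCont : AbsCont σa ρ
  singular : Singular σs ρ

/-- `L` is (a version of) the quantum log-likelihood ratio `𝓛(σ | ρ)`: a Hermitian operator with
`σᵃ = exp (L/2) ρ exp (L/2)`, where `σᵃ` is the absolutely continuous part of `σ` with respect
to `ρ`. It is in general not unique. -/
def IsLogLikelihoodRatio (L σ ρ : Matrix ι ι ℂ) : Prop :=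
  L.IsHermitian ∧ ∃ σa σs : Matrix ι ι ℂ, IsLebesgueDecomp σ ρ σa σs ∧
    σa = NormedSpace.exp ((1 / 2 : ℂ) • L) * ρ * NormedSpace.exp ((1 / 2 : ℂ) • L)

/-- `S` is (a version of) the symmetric logarithmic derivative of the model `θ ↦ ρ θ` at `θ₀` in
the `i`-th direction: `S` is Hermitian and `∂ᵢ ρ (θ₀) = (ρ S + S ρ) / 2`, `ρ = ρ θ₀`. -/
def IsSLD {d : ℕ} (ρ : Param d → Matrix ι ι ℂ) (θ₀ : Param d) (i : Fin d)
    (S : Matrix ι ι ℂ) : Prop :=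
  S.IsHermitian ∧
    HasDerivAt (fun t : ℝ => ρ (θ₀ + t • EuclideanSpace.single i (1 : ℝ)))
      ((1 / 2 : ℂ) • (ρ θ₀ * S + S * ρ θ₀)) 0

/-- The matrix `(Tr ρ A_j B_i)_{ij}`. -/
def covMatrix {κ κ' : Type*} (ρ : Matrix ι ι ℂ) (B : κ → Matrix ι ι ℂ) (A : κ' → Matrix ι ι ℂ) :
    Matrix κ κ' ℂ :=
  Matrix.of fun i j => (ρ * A j * B i).trace

/-- The tensor product `A 0 ⊗ ⋯ ⊗ A (n-1)` on `(ℂ^ι)^{⊗ n} = ℂ^(ι^n)`. -/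
def tensor {n : ℕ} (A : Fin n → Matrix ι ι ℂ) : Matrix (Fin n → ι) (Fin n → ι) ℂ :=
  Matrix.of fun x y => ∏ k, A k (x k) (y k)

/-- `ρ^{⊗ n}`. -/
def tensorPow (n : ℕ) (ρ : Matrix ι ι ℂ) : Matrix (Fin n → ι) (Fin n → ι) ℂ :=
  tensor fun _ => ρ

/-- `n^{-1/2} ∑_k I^{⊗(k-1)} ⊗ B ⊗ I^{⊗(n-k)}`. -/
def normalizedSum (n : ℕ) (B : Matrix ι ι ℂ) : Matrix (Fin n → ι) (Fin n → ι) ℂ :=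
  ((Real.sqrt n : ℝ) : ℂ)⁻¹ • ∑ k : Fin n, tensor (Function.update (fun _ => 1) k B)

end Operators

/-- A quantum statistical model: density operators `ρ θ` indexed by an open set `Θ ⊆ ℝ^d`. (The
values of `ρ` outside `Θ` are irrelevant.) -/
structure IsModel {ι : Type*} [Fintype ι] [DecidableEq ι] {d : ℕ} (Θ : Set (Param d))
    (ρ : Param d → Matrix ι ι ℂ) : Prop where
  isOpen : IsOpen Θ
  isDensity : ∀ θ ∈ Θ, IsDensity (ρ θ)

/-- The quasi-characteristic function `φ (∏_{t=1}^s exp (√-1 ξ_t^i X_i))` of the quantum Gaussian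
state `(X, φ) ∼ N(h, J)`, at `ξ_1, …, ξ_s ∈ ℂ^κ`:
`exp (∑_t (√-1 ξ_t^i h_i - ½ ξ_t^i ξ_t^j J_ji) - ∑_{t<u} ξ_t^i ξ_u^j J_ji)`. -/
def gaussianQuasiChar {κ : Type*} [Fintype κ] (h : κ → ℝ) (J : Matrix κ κ ℂ)
    {s : ℕ} (ξ : Fin s → κ → ℂ) : ℂ :=
  Complex.exp
    (∑ t, (Complex.I * ∑ i, ξ t i * (h i : ℂ) - 1 / 2 * ∑ i, ∑ j, ξ t i * ξ t j * J j i)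
      - ∑ t, ∑ u ∈ Finset.Ioi t, ∑ i, ∑ j, ξ t i * ξ u j * J j i)

section Sequences

variable {N : ℕ → Type*} [∀ n, Fintype (N n)] [∀ n, DecidableEq (N n)]

/-- The sequence `(X⁽ⁿ⁾, ρ⁽ⁿ⁾)` converges in law to the quantum Gaussian state `N(h, J)`; the matrix
`J` of a quantum Gaussian state is Hermitian positive semidefinite. The product is the ordered
one. -/
def ConvergesInLaw {κ : Type*} [Fintype κ] (X : ∀ n, κ → Matrix (N n) (N n) ℂ)
    (ρ : ∀ n, Matrix (N n) (N n) ℂ) (h : κ → ℝ) (J : Matrix κ κ ℂ) : Prop :=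
  J.PosSemidef ∧ ∀ (s : ℕ) (ξ : Fin s → κ → ℂ),
    Tendsto
      (fun n => (ρ n *
        (List.ofFn fun t => NormedSpace.exp (Complex.I • ∑ i, ξ t i • X n i)).prod).trace)
      atTop (𝓝 (gaussianQuasiChar h J ξ))

/-- `R⁽ⁿ⁾ = o(X⁽ⁿ⁾, ρ⁽ⁿ⁾)`: the sequence `R` of observables is infinitesimal relative to the
convergence of `(X⁽ⁿ⁾, ρ⁽ⁿ⁾)` to `N(0, J)`. -/
def IsInfinitesimal {κ : Type*} [Fintype κ] (X : ∀ n, κ → Matrix (N n) (N n) ℂ)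
    (ρ : ∀ n, Matrix (N n) (N n) ℂ) (J : Matrix κ κ ℂ) (R : ∀ n, Matrix (N n) (N n) ℂ) : Prop :=
  ConvergesInLaw X ρ 0 J ∧ (∀ᶠ n in atTop, (R n).IsHermitian) ∧
  ∀ (s : ℕ) (ξ : Fin s → κ → ℂ) (η : Fin s → ℂ),
    Tendsto
      (fun n => (ρ n *
        (List.ofFn fun t =>
          NormedSpace.exp (Complex.I • (∑ i, ξ t i • X n i + η t • R n))).prod).trace)
      atTop (𝓝 (gaussianQuasiChar 0 J ξ))

/-- The pair `({ρ⁽ⁿ⁾_θ}, X⁽ⁿ⁾)` is jointly quantum locally asymptotically normal at `θ₀`, with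
`Δ⁽ⁿ⁾` and the matrices `C` (the covariance of `X`), `τ` and `J` as the objects whose existence is
required. The local parameter `θ₀ + h/√n` lies in `Θ` for all large `n`, and only for such `n` the
log-likelihood ratio `𝓛⁽ⁿ⁾_h` is meaningful; "`𝓛⁽ⁿ⁾_h` is expanded as" means that some version of
it is. -/
structure IsJointlyQLAN {d r : ℕ} (Θ : Set (Param d)) (ρ : ∀ n, Param d → Matrix (N n) (N n) ℂ)
    (θ₀ : Param d) (X : ∀ n, Fin r → Matrix (N n) (N n) ℂ)
    (Δ : ∀ n, Fin d → Matrix (N n) (N n) ℂ)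
    (C : Matrix (Fin r) (Fin r) ℂ) (τ : Matrix (Fin r) (Fin d) ℂ)
    (J : Matrix (Fin d) (Fin d) ℂ) : Prop where
  isModel : ∀ n, 0 < n → IsModel Θ (ρ n)
  mem : θ₀ ∈ Θ
  isHermitian_X : ∀ n, 0 < n → ∀ i, (X n i).IsHermitian
  absCont : ∀ n, 0 < n → ∀ θ ∈ Θ, AbsCont (ρ n θ₀) (ρ n θ)
  isHermitian_Δ : ∀ n, 0 < n → ∀ i, (Δ n i).IsHermitian
  posSemidef_C : C.PosSemidef
  posSemidef_J : J.PosSemidef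
  posDef_re_J : (J.map Complex.re).PosDef
  convergesInLaw : ConvergesInLaw (fun n => Sum.elim (X n) (Δ n)) (fun n => ρ n θ₀) 0
    (Matrix.fromBlocks C τ τᴴ J)
  expansion : ∀ h : Param d, ∃ 𝓛 : ∀ n, Matrix (N n) (N n) ℂ,
    (∀ n : ℕ, 0 < n → θ₀ + (Real.sqrt n)⁻¹ • h ∈ Θ →
      IsLogLikelihoodRatio (𝓛 n) (ρ n (θ₀ + (Real.sqrt n)⁻¹ • h)) (ρ n θ₀)) ∧
    IsInfinitesimal (fun n => Sum.elim (X n) (Δ n)) (fun n => ρ n θ₀)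
      (Matrix.fromBlocks C τ τᴴ J)
      (fun n => 𝓛 n - (∑ i, (h i : ℂ) • Δ n i
        - (1 / 2 * ∑ i, ∑ j, J i j * (h i : ℂ) * (h j : ℂ)) • (1 : Matrix (N n) (N n) ℂ)))

end Sequences

end QLAN

end

/-! Everything reduces to one copy. On tensor powers, a trace of a product of exponentials of
normalized sums is the n-th power of a single-copy trace (`trace_tensorPow_mul_exp`). The product of
the exponentials is 1 + n^{-1/2} aₙ + n⁻¹ b + o(n⁻¹), so the n-th power tends to exp (c + Tr ρ₀ b),
with c = lim √n Tr ρₙ aₙ. This is `tendsto_trace_tensorPow_exp`. It allows both the state and the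
observables to depend on n: a varying state gives (b), varying observables give the remainder of the
log-likelihood ratio in (a).

For the likelihood, let A be the derivative of L along h. The condition Tr ρ e^L = 1 - o(t²) is used
twice. The deficit 1 - Tr ρ e^L is the trace of the singular part, which therefore does not affect
first derivatives. Differentiating e^{L/2} ρ e^{L/2} then shows that A is a symmetric logarithmic
derivative. At second order the same condition gives √n Tr ρ (√n L(h/√n)) → -½ Tr ρ A², which is the
source of the quadratic term and of Tr ρ A = 0.

Two symmetric logarithmic derivatives differ by K with ρ K = K ρ = 0, so K contributes to no second
moment in the state ρ. The remainder is the normalized sum of operators Pₙ → K with √n Tr ρ Pₙ → 0;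
hence it leaves the Gaussian limit unchanged. In (b) the mean is the derivative of Tr ρ_θ B, which
is (Re τ) h. -/

noncomputable section

namespace QLAN

/-! ### Absolute continuity and singularity as matrix identities -/

section AbsoluteContinuity

variable {ι : Type*} [Fintype ι] [DecidableEq ι]

theorem mem_supp_iff {ρ : Matrix ι ι ℂ} (hρ : ρ.IsHermitian) {x : EuclideanSpace ℂ ι} :
    x ∈ supp ρ ↔ ∃ y, Matrix.toEuclideanLin ρ y = x := by
  have h : LinearMap.adjoint (Matrix.toEuclideanLin ρ) = Matrix.toEuclideanLin ρ :=
    ((LinearMap.eq_adjoint_iff _ _).2 (Matrix.isSymmetric_toEuclideanLin_iff.2 hρ)).symm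
  rw [supp, LinearMap.orthogonal_ker, h, LinearMap.mem_range]

theorem inner_toEuclideanLin_self (σ : Matrix ι ι ℂ) (x : EuclideanSpace ℂ ι) :
    inner ℂ x (Matrix.toEuclideanLin σ x) = star x.ofLp ⬝ᵥ (σ *ᵥ x.ofLp) := by
  rw [EuclideanSpace.inner_eq_star_dotProduct, dotProduct_comm]
  rfl

theorem inner_excision (σ ρ : Matrix ι ι ℂ) (x y : supp ρ) :
    inner ℂ x (excision σ ρ y) =
      inner ℂ (x : EuclideanSpace ℂ ι) (Matrix.toEuclideanLin σ (y : EuclideanSpace ℂ ι)) := by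
  rw [excision, LinearMap.comp_apply, LinearMap.adjoint_inner_right]
  rfl

theorem isSymmetric_excision {σ : Matrix ι ι ℂ} (hσ : σ.IsHermitian) (ρ : Matrix ι ι ℂ) :
    LinearMap.IsSymmetric (𝕜 := ℂ) (E := supp ρ) (excision σ ρ) := by
  intro x y
  rw [← inner_conj_symm, inner_excision, inner_excision, inner_conj_symm]
  exact Matrix.isSymmetric_toEuclideanLin_iff.2 hσ _ _

/-- `C` factors through the quotient by the kernel of `A`, that is, through the range of `A`; any
linear extension from the range to the whole space gives `M`. -/
theorem exists_mul_eq_of_ker_le {A C : Matrix ι ι ℂ}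
    (h : ∀ v, A *ᵥ v = 0 → C *ᵥ v = 0) : ∃ M : Matrix ι ι ℂ, M * A = C := by
  have hk : LinearMap.ker (Matrix.toLin' A) ≤ LinearMap.ker (Matrix.toLin' C) := fun v hv => by
    simpa using h v (by simpa using hv)
  obtain ⟨g, hg⟩ := LinearMap.exists_extend
    (((LinearMap.ker (Matrix.toLin' A)).liftQ (Matrix.toLin' C) hk).comp
      (Matrix.toLin' A).quotKerEquivRange.symm.toLinearMap)
  refine ⟨LinearMap.toMatrix' g, Matrix.toLin'.injective ?_⟩
  rw [Matrix.toLin'_mul, Matrix.toLin'_toMatrix']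
  refine LinearMap.ext fun v => ?_
  have h2 := LinearMap.congr_fun hg (⟨Matrix.toLin' A v, LinearMap.mem_range_self _ v⟩)
  have h3 : (Matrix.toLin' A).quotKerEquivRange.symm
      ⟨Matrix.toLin' A v, LinearMap.mem_range_self _ v⟩ = Submodule.Quotient.mk v := by
    rw [LinearEquiv.symm_apply_eq]
    rfl
  simp only [LinearMap.comp_apply, LinearEquiv.coe_coe, h3] at h2
  exact h2

/-- For `ρ` Hermitian and `σ ≥ 0`, `ρ ≪ σ` means that `ρ` can be recovered from `ρ σ ρ` by a
multiplication on the left. -/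
theorem absCont_iff {ρ σ : Matrix ι ι ℂ} (hρ : ρ.IsHermitian) (hσ : σ.PosSemidef) :
    AbsCont ρ σ ↔ ∃ M : Matrix ι ι ℂ, M * (ρ * σ * ρ) = ρ := by
  constructor
  · rintro ⟨-, hpos⟩
    refine exists_mul_eq_of_ker_le fun v hv => ?_
    -- A vector v with ρσρv = 0 and ρv ≠ 0 would give a nonzero element ρv of the support at which
    -- the form of σ vanishes.
    by_contra hne
    have hmem : Matrix.toEuclideanLin ρ (WithLp.toLp 2 v) ∈ supp ρ :=
      (mem_supp_iff hρ).2 ⟨_, rfl⟩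
    have h := hpos ⟨_, hmem⟩ (fun h0 => hne (by
      have := congrArg (fun z : supp ρ => (z : EuclideanSpace ℂ ι).ofLp) h0
      simpa using this))
    rw [inner_excision, inner_toEuclideanLin_self] at h
    have h1 : (Matrix.toEuclideanLin ρ (WithLp.toLp 2 v)).ofLp = ρ *ᵥ v := rfl
    have h2 : star (ρ *ᵥ v) ⬝ᵥ (σ *ᵥ (ρ *ᵥ v)) = star v ⬝ᵥ ((ρ * σ * ρ) *ᵥ v) := by
      rw [Matrix.star_mulVec, hρ.eq, ← Matrix.dotProduct_mulVec, Matrix.mulVec_mulVec,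
        Matrix.mulVec_mulVec, Matrix.mul_assoc]
    simp only [h1] at h
    rw [h2, hv] at h
    simp at h
  · rintro ⟨M, hM⟩
    refine ⟨isSymmetric_excision hσ.isHermitian ρ, fun x hx => ?_⟩
    rw [inner_excision, inner_toEuclideanLin_self]
    refine lt_of_le_of_ne (hσ.re_dotProduct_nonneg _) fun h0 => hx ?_
    have h1 : star (x : EuclideanSpace ℂ ι).ofLp ⬝ᵥ (σ *ᵥ (x : EuclideanSpace ℂ ι).ofLp) = 0 :=
      Complex.ext h0.symm (Complex.nonneg_iff.1 (hσ.dotProduct_mulVec_nonneg _)).2.symm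
    rw [hσ.dotProduct_mulVec_zero_iff] at h1
    obtain ⟨y, hy⟩ := (mem_supp_iff hρ).1 x.2
    have hy' : (x : EuclideanSpace ℂ ι).ofLp = ρ *ᵥ y.ofLp := by rw [← hy]; rfl
    apply Subtype.ext
    apply (WithLp.ofLp_injective 2)
    change (x : EuclideanSpace ℂ ι).ofLp = 0
    -- x = ρy = Mρσρy = Mρ(σx) = 0.
    rw [hy', ← hM, ← Matrix.mulVec_mulVec, Matrix.mul_assoc, ← Matrix.mulVec_mulVec,
      ← Matrix.mulVec_mulVec, ← hy', h1]
    simp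

/-- A positive semidefinite form that vanishes at a vector has that vector in its kernel; the
vectors ρv exhaust the support. In this form singularity passes to tensor powers. -/
theorem mul_eq_zero_of_singular {ρ σ : Matrix ι ι ℂ} (hρ : ρ.IsHermitian) (hσ : σ.PosSemidef)
    (h : Singular ρ σ) : σ * ρ = 0 := by
  have hv : ∀ v, (σ * ρ) *ᵥ v = 0 := fun v => by
    have hmem : Matrix.toEuclideanLin ρ (WithLp.toLp 2 v) ∈ supp ρ :=
      (mem_supp_iff hρ).2 ⟨_, rfl⟩
    have h0 := inner_excision σ ρ ⟨_, hmem⟩ ⟨_, hmem⟩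
    rw [h, inner_toEuclideanLin_self] at h0
    rw [← Matrix.mulVec_mulVec]
    exact (hσ.dotProduct_mulVec_zero_iff _).1 (by simpa using h0.symm)
  exact Matrix.toLin'.injective (LinearMap.ext fun v => by simpa using hv v)

theorem singular_of_mul_eq_zero {ρ σ : Matrix ι ι ℂ} (hρ : ρ.IsHermitian)
    (h : σ * ρ = 0) : Singular ρ σ := by
  refine LinearMap.ext fun x => ?_
  obtain ⟨y, hy⟩ := (mem_supp_iff hρ).1 x.2
  have h0 : Matrix.toEuclideanLin σ (x : EuclideanSpace ℂ ι) = 0 := by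
    rw [← hy]
    apply (WithLp.ofLp_injective 2)
    change σ *ᵥ (ρ *ᵥ y.ofLp) = 0
    rw [Matrix.mulVec_mulVec, h, Matrix.zero_mulVec]
  simp [excision, h0]

theorem posSemidef_exists_factor {A : Matrix ι ι ℂ} (hA : A.PosSemidef) :
    ∃ C : Matrix ι ι ℂ, A = Cᴴ * C := by
  open scoped MatrixOrder in
  exact CStarAlgebra.nonneg_iff_eq_star_mul_self.1 (Matrix.nonneg_iff_posSemidef.2 hA)

/-- If `K ρ K = 0` for Hermitian `K` and `ρ ≥ 0`, then `ρ K = 0`. -/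
theorem mul_eq_zero_of_conj_eq_zero {ρ K : Matrix ι ι ℂ} (hρ : ρ.PosSemidef)
    (hK : K.IsHermitian) (h : (K * ρ * K).trace = 0) : ρ * K = 0 := by
  obtain ⟨C, rfl⟩ := posSemidef_exists_factor hρ
  -- With ρ = CᴴC the trace is the squared Hilbert–Schmidt norm of CK.
  have h1 : ((C * K)ᴴ * (C * K)).trace = 0 := by
    rw [Matrix.conjTranspose_mul, hK.eq, ← h]
    simp only [Matrix.mul_assoc]
  rw [Matrix.mul_assoc, Matrix.trace_conjTranspose_mul_self_eq_zero_iff.1 h1, Matrix.mul_zero]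

end AbsoluteContinuity

/-! ### Tensor powers, their exponentials, and likelihood ratios of independent copies -/

section Tensor

variable {ι : Type*} {n : ℕ}

theorem tensor_one [DecidableEq ι] : tensor (fun _ : Fin n => (1 : Matrix ι ι ℂ)) = 1 := by
  ext x y
  simp only [tensor, Matrix.of_apply, Matrix.one_apply, funext_iff]
  by_cases h : ∀ k, x k = y k
  · simp [h]
  · obtain ⟨k, hk⟩ := not_forall.1 h
    rw [if_neg h]
    exact Finset.prod_eq_zero (Finset.mem_univ k) (if_neg hk)

theorem tensor_conjTranspose (A : Fin n → Matrix ι ι ℂ) :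
    (tensor A)ᴴ = tensor fun k => (A k)ᴴ := by
  ext x y
  simp [tensor, Matrix.conjTranspose_apply]

theorem tensor_add (A C : Fin n → Matrix ι ι ℂ) :
    tensor (fun k => A k + C k) =
      ∑ s : Finset (Fin n), tensor (fun k => if k ∈ s then A k else C k) := by
  ext x y
  simp only [tensor, Matrix.of_apply, Matrix.add_apply, Matrix.sum_apply]
  rw [Finset.prod_add, Finset.powerset_univ]
  refine Finset.sum_congr rfl fun s _ => ?_
  rw [← Finset.prod_mul_prod_compl s, Finset.compl_eq_univ_sdiff]
  congr 1
  · exact Finset.prod_congr rfl fun k hk => by rw [if_pos hk]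
  · exact Finset.prod_congr rfl fun k hk => by rw [if_neg (Finset.mem_sdiff.1 hk).2]

theorem isHermitian_tensor {A : Fin n → Matrix ι ι ℂ} (hA : ∀ k, (A k).IsHermitian) :
    (tensor A).IsHermitian := by
  rw [Matrix.IsHermitian, tensor_conjTranspose]
  exact congrArg tensor (funext hA)

variable [Fintype ι]

theorem tensor_mul (A C : Fin n → Matrix ι ι ℂ) :
    tensor A * tensor C = tensor fun k => A k * C k := by
  ext x y
  simp only [tensor, Matrix.mul_apply, Matrix.of_apply, ← Finset.prod_mul_distrib,
    Finset.prod_univ_sum, Fintype.piFinset_univ]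

theorem trace_tensor (A : Fin n → Matrix ι ι ℂ) : (tensor A).trace = ∏ k, (A k).trace := by
  simp only [tensor, Matrix.trace, Matrix.diag_apply, Matrix.of_apply, Finset.prod_univ_sum,
    Fintype.piFinset_univ]

variable [DecidableEq ι]

theorem posSemidef_tensor {A : Fin n → Matrix ι ι ℂ} (hA : ∀ k, (A k).PosSemidef) :
    (tensor A).PosSemidef := by
  choose C hC using fun k => posSemidef_exists_factor (hA k)
  have h : tensor A = (tensor C)ᴴ * tensor C := by
    rw [tensor_conjTranspose, tensor_mul]
    exact congrArg tensor (funext hC)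
  rw [h]
  exact Matrix.posSemidef_conjTranspose_mul_self _

/-- Expanding the tensor product over the subsets of sites that carry `A`, the full subset gives
`tensor A`; every other term is a tensor product of positive semidefinite factors. -/
theorem posSemidef_tensor_sub {A C : Fin n → Matrix ι ι ℂ} (hA : ∀ k, (A k).PosSemidef)
    (hC : ∀ k, (C k).PosSemidef) : (tensor (fun k => A k + C k) - tensor A).PosSemidef := by
  have h : tensor (fun k => A k + C k) - tensor A =
      ∑ s ∈ Finset.univ.erase (Finset.univ : Finset (Fin n)),
        tensor (fun k => if k ∈ s then A k else C k) := by
    rw [tensor_add, ← Finset.add_sum_erase _ _ (Finset.mem_univ (Finset.univ : Finset (Fin n)))]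
    simp
  rw [h]
  refine Matrix.posSemidef_sum _ fun s _ => posSemidef_tensor fun k => ?_
  split_ifs
  exacts [hA k, hC k]

/-- `B ↦ I^{⊗(k-1)} ⊗ B ⊗ I^{⊗(n-k)}`. -/
def embed (k : Fin n) : Matrix ι ι ℂ →ₐ[ℂ] Matrix (Fin n → ι) (Fin n → ι) ℂ :=
  AlgHom.ofLinearMap
    { toFun := fun B => tensor (Function.update (fun _ => 1) k B)
      map_add' := fun B C => by
        ext x y
        simp only [tensor, Matrix.of_apply, Matrix.add_apply,
          ← Finset.mul_prod_erase _ _ (Finset.mem_univ k), Function.update_self, add_mul]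
        congr 2 <;> refine Finset.prod_congr rfl fun j hj => ?_ <;>
          simp [Function.update_of_ne (Finset.ne_of_mem_erase hj)]
      map_smul' := fun c B => by
        ext x y
        simp only [tensor, Matrix.of_apply, Matrix.smul_apply, RingHom.id_apply, smul_eq_mul,
          ← Finset.mul_prod_erase _ _ (Finset.mem_univ k), Function.update_self, mul_assoc]
        congr 2
        refine Finset.prod_congr rfl fun j hj => ?_
        simp [Function.update_of_ne (Finset.ne_of_mem_erase hj)] }
    (by
      change tensor (Function.update (fun _ => 1) k 1) = 1
      rw [Function.update_eq_self_iff.2 rfl, tensor_one])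
    (fun B C => by
      change tensor (Function.update (fun _ => 1) k (B * C)) = tensor _ * tensor _
      rw [tensor_mul]
      congr 1
      funext j
      by_cases hj : j = k
      · subst hj; simp
      · simp [hj])

theorem embed_apply (k : Fin n) (B : Matrix ι ι ℂ) :
    embed k B = tensor (Function.update (fun _ => 1) k B) := rfl

theorem isHermitian_embed (k : Fin n) {B : Matrix ι ι ℂ} (hB : B.IsHermitian) :
    (embed k B).IsHermitian := by
  refine isHermitian_tensor fun j => ?_
  by_cases hj : j = k
  · subst hj; simpa using hB
  · simp [hj]

theorem commute_embed {j k : Fin n} (hjk : j ≠ k) (B C : Matrix ι ι ℂ) :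
    Commute (embed j B) (embed k C) := by
  rw [Commute, SemiconjBy, embed_apply, embed_apply, tensor_mul, tensor_mul]
  congr 1
  funext l
  by_cases hj : l = j
  · subst hj; simp [hjk]
  · simp [hj]

theorem exp_embed (k : Fin n) (B : Matrix ι ι ℂ) :
    NormedSpace.exp (embed k B) = embed k (NormedSpace.exp B) := by
  have hc : Continuous (embed (ι := ι) k) :=
    LinearMap.continuous_of_finiteDimensional (embed (ι := ι) k).toLinearMap
  open scoped Matrix.Norms.Operator in
  exact (NormedSpace.map_exp (embed (ι := ι) k) hc B).symm

theorem exp_sum_embed (B : Matrix ι ι ℂ) :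
    NormedSpace.exp (∑ k : Fin n, embed k B) = tensor fun _ => NormedSpace.exp B := by
  -- Embeddings at different sites commute, so the exponential can be built up one site at a time.
  have h : ∀ s : Finset (Fin n), NormedSpace.exp (∑ k ∈ s, embed k B) =
      tensor fun k => if k ∈ s then NormedSpace.exp B else 1 := fun s => by
    induction s using Finset.induction_on with
    | empty => simp [tensor_one, NormedSpace.exp_zero]
    | insert a s ha ih =>
      rw [Finset.sum_insert ha, Matrix.exp_add_of_commute, ih, exp_embed, embed_apply, tensor_mul]
      · congr 1
        funext j
        by_cases hj : j = a
        · subst hj; simp [ha]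
        · simp [hj]
      · exact Commute.sum_right _ _ _ fun j hj =>
          commute_embed (ne_of_mem_of_not_mem hj ha).symm _ _
  simpa using h Finset.univ

theorem normalizedSum_eq (B : Matrix ι ι ℂ) :
    normalizedSum n B = ((Real.sqrt n : ℝ) : ℂ)⁻¹ • ∑ k : Fin n, embed k B := rfl

theorem isHermitian_normalizedSum {B : Matrix ι ι ℂ} (hB : B.IsHermitian) :
    (normalizedSum n B).IsHermitian := by
  rw [normalizedSum_eq, Matrix.IsHermitian, Matrix.conjTranspose_smul, Matrix.conjTranspose_sum]
  simp [(isHermitian_embed _ hB).eq]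

/-- `normalizedSum n` as a linear map. -/
def normalizedSumLin (n : ℕ) : Matrix ι ι ℂ →ₗ[ℂ] Matrix (Fin n → ι) (Fin n → ι) ℂ :=
  ((Real.sqrt n : ℝ) : ℂ)⁻¹ • ∑ k : Fin n, (embed k).toLinearMap

theorem normalizedSumLin_apply (B : Matrix ι ι ℂ) :
    normalizedSumLin n B = normalizedSum n B := by
  simp [normalizedSumLin, normalizedSum_eq, LinearMap.sum_apply]

/-- n/√n = √n. Scalar shifts on n copies can thus be absorbed into a single-copy observable. -/
theorem normalizedSum_one (hn : 0 < n) :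
    normalizedSum n (1 : Matrix ι ι ℂ) = ((Real.sqrt n : ℝ) : ℂ) • 1 := by
  have h : ((Real.sqrt n : ℝ) : ℂ)⁻¹ * n = ((Real.sqrt n : ℝ) : ℂ) := by
    have h1 : ((Real.sqrt n : ℝ) : ℂ) * ((Real.sqrt n : ℝ) : ℂ) = n := by
      exact_mod_cast Real.mul_self_sqrt (Nat.cast_nonneg n)
    have h2 : ((Real.sqrt n : ℝ) : ℂ) ≠ 0 := by
      exact_mod_cast (Real.sqrt_pos.2 (Nat.cast_pos.2 hn)).ne'
    rw [← h1, inv_mul_cancel_left₀ h2]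
  rw [normalizedSum_eq]
  simp only [map_one, Finset.sum_const, Finset.card_univ, Fintype.card_fin]
  rw [← Nat.cast_smul_eq_nsmul ℂ, smul_smul, h]

theorem exp_smul_normalizedSum (c : ℂ) (B : Matrix ι ι ℂ) :
    NormedSpace.exp (c • normalizedSum n B) =
      tensor fun _ => NormedSpace.exp ((((Real.sqrt n : ℝ) : ℂ)⁻¹ * c) • B) := by
  rw [← exp_sum_embed, normalizedSum_eq, smul_smul, mul_comm]
  simp only [map_smul, Finset.smul_sum]

theorem prod_ofFn_tensorPow {s : ℕ} (E : Fin s → Matrix ι ι ℂ) :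
    (List.ofFn fun t => tensor fun _ : Fin n => E t).prod = tensor fun _ => (List.ofFn E).prod := by
  induction s with
  | zero => simp [tensor_one]
  | succ s ih => simp [List.ofFn_succ, ih, tensor_mul]

theorem trace_tensorPow_mul_exp {s : ℕ} (ρ : Matrix ι ι ℂ) (Y : Fin s → Matrix ι ι ℂ) :
    (tensorPow n ρ *
      (List.ofFn fun t => NormedSpace.exp (Complex.I • normalizedSum n (Y t))).prod).trace =
    (ρ * (List.ofFn fun t =>
      NormedSpace.exp ((((Real.sqrt n : ℝ) : ℂ)⁻¹ * Complex.I) • Y t)).prod).trace ^ n := by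
  simp only [exp_smul_normalizedSum, prod_ofFn_tensorPow, tensorPow, tensor_mul, trace_tensor,
    Finset.prod_const, Finset.card_univ, Fintype.card_fin]

theorem isDensity_tensorPow {ρ : Matrix ι ι ℂ} (hρ : IsDensity ρ) :
    IsDensity (tensorPow n ρ) :=
  ⟨posSemidef_tensor fun _ => hρ.posSemidef, by simp [tensorPow, trace_tensor, hρ.trace_eq_one]⟩

theorem absCont_tensorPow {ρ σ : Matrix ι ι ℂ} (hρ : ρ.PosSemidef) (hσ : σ.PosSemidef)
    (h : AbsCont ρ σ) : AbsCont (tensorPow n ρ) (tensorPow n σ) := by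
  obtain ⟨M, hM⟩ := (absCont_iff hρ.isHermitian hσ).1 h
  refine (absCont_iff (posSemidef_tensor fun _ => hρ).isHermitian
    (posSemidef_tensor fun _ => hσ)).2 ⟨tensorPow n M, ?_⟩
  simp only [tensorPow, tensor_mul, hM]

theorem isLebesgueDecomp_tensorPow {ρ σ σa σs : Matrix ι ι ℂ} (hρ : ρ.PosSemidef)
    (h : IsLebesgueDecomp σ ρ σa σs) :
    IsLebesgueDecomp (tensorPow n σ) (tensorPow n ρ) (tensorPow n σa)
      (tensorPow n σ - tensorPow n σa) := by
  have hs : (tensorPow n σ - tensorPow n σa).PosSemidef := by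
    rw [h.eq_add]
    exact posSemidef_tensor_sub (fun _ => h.posSemidef_ac) (fun _ => h.posSemidef_sing)
  -- Since ρσs = 0, ρσ = ρσa, and so ρ^{⊗n} annihilates the difference σ^{⊗n} - σa^{⊗n}, although
  -- this is not itself a tensor power of σs.
  have h0 : ρ * σs = 0 := mul_eq_zero_of_singular h.posSemidef_sing.isHermitian hρ h.singular
  refine ⟨by simp, posSemidef_tensor fun _ => h.posSemidef_ac, hs,
    absCont_tensorPow h.posSemidef_ac hρ h.absCont,
    singular_of_mul_eq_zero hs.isHermitian ?_⟩
  simp only [tensorPow, mul_sub, tensor_mul, h.eq_add, mul_add, h0, add_zero, sub_self]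

theorem isLogLikelihoodRatio_tensorPow {L ρ σ : Matrix ι ι ℂ} (hρ : ρ.PosSemidef)
    (h : IsLogLikelihoodRatio L σ ρ) :
    IsLogLikelihoodRatio (∑ k : Fin n, embed k L) (tensorPow n σ) (tensorPow n ρ) := by
  obtain ⟨hL, σa, σs, hd, he⟩ := h
  refine ⟨?_, tensorPow n σa, _, isLebesgueDecomp_tensorPow hρ hd, ?_⟩
  · rw [Matrix.IsHermitian, Matrix.conjTranspose_sum]
    simp [(isHermitian_embed _ hL).eq]
  · simp only [Finset.smul_sum, ← map_smul, exp_sum_embed, tensorPow, tensor_mul, he]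

end Tensor

/-! ### Second-order expansions and the quantum central limit theorem -/

section Expansion

theorem isBigO_exp_sub_taylor {𝔸 : Type*} [NormedRing 𝔸] [NormedAlgebra ℂ 𝔸] [CompleteSpace 𝔸] :
    (fun y : 𝔸 => NormedSpace.exp y - 1 - y - (1 / 2 : ℂ) • (y * y)) =O[𝓝 0]
      fun y => ‖y‖ ^ 3 := by
  have h := (NormedSpace.exp_hasFPowerSeriesAt_zero (𝕂 := ℂ) (𝔸 := 𝔸)).isBigO_sub_partialSum_pow 3
  refine h.congr_left fun y => ?_
  simp [FormalMultilinearSeries.partialSum, Finset.sum_range_succ, NormedSpace.expSeries_apply_eq,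
    pow_two, sub_sub, add_assoc]

theorem natCast_eq_sqrt_mul_sqrt (n : ℕ) :
    (n : ℂ) = ((Real.sqrt n : ℝ) : ℂ) * ((Real.sqrt n : ℝ) : ℂ) := by
  exact_mod_cast (Real.mul_self_sqrt (Nat.cast_nonneg n)).symm

theorem sqrt_natCast_ne_zero {n : ℕ} (hn : 0 < n) : ((Real.sqrt n : ℝ) : ℂ) ≠ 0 := by
  exact_mod_cast (Real.sqrt_pos.2 (Nat.cast_pos.2 hn)).ne'

theorem tendsto_inv_sqrt_natCast :
    Tendsto (fun n : ℕ => (Real.sqrt n)⁻¹) atTop (𝓝 0) :=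
  (Real.tendsto_sqrt_atTop.comp tendsto_natCast_atTop_atTop).inv_tendsto_atTop

theorem tendsto_inv_sqrt_natCast_complex :
    Tendsto (fun n : ℕ => ((Real.sqrt n : ℝ) : ℂ)⁻¹) atTop (𝓝 0) := by
  have h := (Complex.continuous_ofReal.tendsto 0).comp tendsto_inv_sqrt_natCast
  simpa [Function.comp_def] using h

theorem tendsto_exp_remainder {𝔸 : Type*} [NormedRing 𝔸] [NormedAlgebra ℂ 𝔸] [CompleteSpace 𝔸]
    {a : ℕ → 𝔸} {a₀ : 𝔸} (ha : Tendsto a atTop (𝓝 a₀)) :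
    Tendsto (fun n : ℕ => (n : ℂ) • (NormedSpace.exp (((Real.sqrt n : ℝ) : ℂ)⁻¹ • a n) - 1
      - ((Real.sqrt n : ℝ) : ℂ)⁻¹ • a n)) atTop (𝓝 ((1 / 2 : ℂ) • (a₀ * a₀))) := by
  set y : ℕ → 𝔸 := fun n => ((Real.sqrt n : ℝ) : ℂ)⁻¹ • a n with hy
  have hy0 : Tendsto y atTop (𝓝 0) := by
    simpa using tendsto_inv_sqrt_natCast_complex.smul ha
  obtain ⟨C, hC⟩ := (isBigO_exp_sub_taylor (𝔸 := 𝔸)).bound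
  -- The cubic Taylor remainder at n^{-1/2} aₙ is O(n^{-3/2}), hence negligible after multiplication
  -- by n.
  have hrem : Tendsto (fun n : ℕ => (n : ℂ) •
      (NormedSpace.exp (y n) - 1 - y n - (1 / 2 : ℂ) • (y n * y n))) atTop (𝓝 0) := by
    have hb : Tendsto (fun n : ℕ => C * ((Real.sqrt n)⁻¹ * ‖a n‖ ^ 3)) atTop (𝓝 0) := by
      simpa using (tendsto_inv_sqrt_natCast.mul (ha.norm.pow 3)).const_mul C
    refine squeeze_zero_norm' ?_ hb
    filter_upwards [hy0.eventually hC, eventually_gt_atTop 0] with n hn hpos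
    have hs : 0 < Real.sqrt n := Real.sqrt_pos.2 (Nat.cast_pos.2 hpos)
    have hsq : (n : ℝ) = Real.sqrt n ^ 2 := (Real.sq_sqrt (Nat.cast_nonneg n)).symm
    have hyn : ‖y n‖ = (Real.sqrt n)⁻¹ * ‖a n‖ := by
      simp [hy, norm_smul, abs_of_pos hs]
    calc ‖(n : ℂ) • (NormedSpace.exp (y n) - 1 - y n - (1 / 2 : ℂ) • (y n * y n))‖
        = (n : ℝ) * ‖NormedSpace.exp (y n) - 1 - y n - (1 / 2 : ℂ) • (y n * y n)‖ := by
          rw [norm_smul]; simp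
      _ ≤ (n : ℝ) * (C * ‖‖y n‖ ^ 3‖) := by gcongr
      _ = C * ((Real.sqrt n)⁻¹ * ‖a n‖ ^ 3) := by
          rw [norm_pow, norm_norm, hyn, hsq, Real.sqrt_sq hs.le]
          field_simp
  have hmain := hrem.add ((ha.mul ha).const_smul (1 / 2 : ℂ))
  rw [zero_add] at hmain
  refine hmain.congr' ?_
  filter_upwards [eventually_gt_atTop 0] with n hpos
  have hne := sqrt_natCast_ne_zero hpos
  have : (n : ℂ) • (1 / 2 : ℂ) • (y n * y n) = (1 / 2 : ℂ) • (a n * a n) := by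
    rw [hy]
    simp only [smul_mul_smul_comm, smul_smul]
    congr 1
    rw [natCast_eq_sqrt_mul_sqrt n]
    field_simp
  rw [smul_sub _ _ ((1 / 2 : ℂ) • _), this, sub_add_cancel]

variable {ι : Type*} [DecidableEq ι]

/-- `E n = 1 + n^{-1/2} a n + n⁻¹ b + o(n⁻¹)` where `a n → a₀`. -/
structure HasExpansion (E a : ℕ → Matrix ι ι ℂ) (a₀ b : Matrix ι ι ℂ) : Prop where
  tendsto_fst : Tendsto a atTop (𝓝 a₀)
  tendsto_snd : Tendsto (fun n : ℕ => (n : ℂ) • (E n - 1 - ((Real.sqrt n : ℝ) : ℂ)⁻¹ • a n))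
    atTop (𝓝 b)

theorem HasExpansion.tendsto_sqrt_smul {E a : ℕ → Matrix ι ι ℂ} {a₀ b : Matrix ι ι ℂ}
    (h : HasExpansion E a a₀ b) :
    Tendsto (fun n : ℕ => ((Real.sqrt n : ℝ) : ℂ) • (E n - 1)) atTop (𝓝 a₀) := by
  have h1 := h.tendsto_fst.add (tendsto_inv_sqrt_natCast_complex.smul h.tendsto_snd)
  rw [zero_smul, add_zero] at h1
  refine h1.congr' ?_
  filter_upwards [eventually_gt_atTop 0] with n hpos
  have hne := sqrt_natCast_ne_zero hpos
  rw [natCast_eq_sqrt_mul_sqrt n, smul_smul, inv_mul_cancel_left₀ hne, smul_sub, smul_smul,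
    mul_inv_cancel₀ hne, one_smul, add_sub_cancel]

theorem hasExpansion_one : HasExpansion (fun _ => (1 : Matrix ι ι ℂ)) (fun _ => 0) 0 0 :=
  ⟨tendsto_const_nhds, by simp⟩

variable [Fintype ι]

/-- EE' - 1 = (E - 1) + (E' - 1) + (E - 1)(E' - 1), and n times the last product is the product of
the two limits of √n (E - 1) and √n (E' - 1). Its order is kept, which is how the ordered cross
terms t < u of the quasi-characteristic function arise. -/
theorem HasExpansion.mul {E a E' a' : ℕ → Matrix ι ι ℂ} {a₀ b a₀' b' : Matrix ι ι ℂ}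
    (h : HasExpansion E a a₀ b) (h' : HasExpansion E' a' a₀' b') :
    HasExpansion (fun n => E n * E' n) (fun n => a n + a' n) (a₀ + a₀') (b + b' + a₀ * a₀') := by
  refine ⟨h.tendsto_fst.add h'.tendsto_fst, ?_⟩
  refine ((h.tendsto_snd.add h'.tendsto_snd).add
    (h.tendsto_sqrt_smul.mul h'.tendsto_sqrt_smul)).congr fun n => ?_
  rw [smul_mul_smul_comm, ← natCast_eq_sqrt_mul_sqrt, ← smul_add, ← smul_add]
  congr 1
  rw [smul_add]
  noncomm_ring

theorem hasExpansion_exp {a : ℕ → Matrix ι ι ℂ} {a₀ : Matrix ι ι ℂ}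
    (ha : Tendsto a atTop (𝓝 a₀)) :
    HasExpansion (fun n => NormedSpace.exp (((Real.sqrt n : ℝ) : ℂ)⁻¹ • a n)) a a₀
      ((1 / 2 : ℂ) • (a₀ * a₀)) := by
  refine ⟨ha, ?_⟩
  open scoped Matrix.Norms.Operator in
  exact tendsto_exp_remainder ha

theorem hasExpansion_prod_exp {s : ℕ} {a : ℕ → Fin s → Matrix ι ι ℂ} {a₀ : Fin s → Matrix ι ι ℂ}
    (ha : ∀ t, Tendsto (fun n => a n t) atTop (𝓝 (a₀ t))) :
    HasExpansion
      (fun n => (List.ofFn fun t => NormedSpace.exp (((Real.sqrt n : ℝ) : ℂ)⁻¹ • a n t)).prod)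
      (fun n => ∑ t, a n t) (∑ t, a₀ t)
      (∑ t, (1 / 2 : ℂ) • (a₀ t * a₀ t) + ∑ t, ∑ u ∈ Finset.Ioi t, a₀ t * a₀ u) := by
  induction s with
  | zero => simpa using hasExpansion_one
  | succ s ih =>
    have h := (hasExpansion_exp (ha 0)).mul (ih fun t => ha t.succ)
    simp only [List.ofFn_succ, List.prod_cons, Fin.sum_univ_succ, Fin.sum_Ioi_zero,
      Fin.sum_Ioi_succ]
    convert h using 1
    rw [Finset.mul_sum]
    abel

/-- With Tr ρₙ = 1, n (Tr ρₙEₙ - 1) converges, and (1 + zₙ/n)ⁿ → e^z when zₙ → z. The first-order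
term needs its own hypothesis `hc`, since Tr ρₙaₙ must be of order n^{-1/2}. -/
theorem HasExpansion.tendsto_trace_mul_pow {E a ρ : ℕ → Matrix ι ι ℂ} {a₀ b ρ₀ : Matrix ι ι ℂ}
    (h : HasExpansion E a a₀ b) (hρ : Tendsto ρ atTop (𝓝 ρ₀)) (htr : ∀ᶠ n in atTop, (ρ n).trace = 1)
    {c : ℂ} (hc : Tendsto (fun n : ℕ => ((Real.sqrt n : ℝ) : ℂ) * (ρ n * a n).trace) atTop (𝓝 c)) :
    Tendsto (fun n => (ρ n * E n).trace ^ n) atTop (𝓝 (Complex.exp (c + (ρ₀ * b).trace))) := by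
  have htrace : Continuous (Matrix.trace : Matrix ι ι ℂ → ℂ) := continuous_id.matrix_trace
  have h1 : Tendsto (fun n : ℕ => (n : ℂ) * ((ρ n * E n).trace - 1)) atTop
      (𝓝 (c + (ρ₀ * b).trace)) := by
    refine (hc.add ((htrace.tendsto _).comp (hρ.mul h.tendsto_snd))).congr' ?_
    filter_upwards [htr, eventually_gt_atTop 0] with n hn hpos
    have hne := sqrt_natCast_ne_zero hpos
    simp only [Function.comp_apply, Matrix.mul_smul, Matrix.mul_sub, Matrix.trace_smul,
      Matrix.trace_sub, Matrix.mul_one, hn, smul_eq_mul]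
    rw [natCast_eq_sqrt_mul_sqrt n]
    field_simp
    ring
  refine (Complex.tendsto_one_add_pow_exp_of_tendsto h1).congr fun n => ?_
  rw [add_sub_cancel]

/-- The quantum central limit theorem for independent copies of a converging sequence of states
and converging observables. -/
theorem tendsto_trace_tensorPow_exp {s : ℕ} {ρ : ℕ → Matrix ι ι ℂ} {ρ₀ : Matrix ι ι ℂ}
    (hρ : Tendsto ρ atTop (𝓝 ρ₀)) (htr : ∀ᶠ n in atTop, (ρ n).trace = 1)
    {Y : ℕ → Fin s → Matrix ι ι ℂ} {Y₀ : Fin s → Matrix ι ι ℂ}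
    (hY : ∀ t, Tendsto (fun n => Y n t) atTop (𝓝 (Y₀ t))) {c : Fin s → ℂ}
    (hc : ∀ t, Tendsto (fun n : ℕ => ((Real.sqrt n : ℝ) : ℂ) * (ρ n * Y n t).trace) atTop
      (𝓝 (c t))) :
    Tendsto (fun n => (tensorPow n (ρ n) *
        (List.ofFn fun t => NormedSpace.exp (Complex.I • normalizedSum n (Y n t))).prod).trace)
      atTop (𝓝 (Complex.exp (∑ t, (Complex.I * c t - 1 / 2 * (ρ₀ * Y₀ t * Y₀ t).trace)
        - ∑ t, ∑ u ∈ Finset.Ioi t, (ρ₀ * Y₀ t * Y₀ u).trace))) := by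
  have h := (hasExpansion_prod_exp fun t => (hY t).const_smul Complex.I).tendsto_trace_mul_pow
    hρ htr (c := ∑ t, Complex.I * c t) (by
      refine (tendsto_finsetSum _ fun t _ => (hc t).const_mul Complex.I).congr fun n => ?_
      simp only [Finset.mul_sum, Matrix.trace_sum, Matrix.mul_smul, Matrix.trace_smul, smul_eq_mul]
      exact Finset.sum_congr rfl fun t _ => by ring)
  simp only [smul_smul] at h
  simp only [trace_tensorPow_mul_exp]
  convert h using 3
  simp only [smul_mul_smul_comm, Complex.I_mul_I, smul_smul, Matrix.mul_add, Matrix.mul_sum,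
    Matrix.trace_add, Matrix.trace_sum, Matrix.mul_smul, Matrix.trace_smul, smul_eq_mul,
    Finset.sum_sub_distrib, Matrix.mul_assoc]
  simp only [mul_neg, mul_one, neg_mul, one_mul, Finset.sum_neg_distrib]
  ring

end Expansion

/-! ### Covariance matrices and convergence of normalized sums -/

section Covariance

variable {ι : Type*} [Fintype ι] {κ : Type*}

theorem star_trace_mul_mul {ρ A C : Matrix ι ι ℂ} (hρ : ρ.IsHermitian) (hA : A.IsHermitian)
    (hC : C.IsHermitian) : star (ρ * A * C).trace = (ρ * C * A).trace := by
  rw [← Matrix.trace_conjTranspose, Matrix.conjTranspose_mul, Matrix.conjTranspose_mul, hρ.eq,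
    hA.eq, hC.eq, ← Matrix.mul_assoc, Matrix.trace_mul_comm, Matrix.mul_assoc]

theorem covMatrix_conjTranspose {κ' : Type*} {ρ : Matrix ι ι ℂ} (hρ : ρ.IsHermitian)
    {B : κ → Matrix ι ι ℂ} (hB : ∀ i, (B i).IsHermitian) {A : κ' → Matrix ι ι ℂ}
    (hA : ∀ i, (A i).IsHermitian) : (covMatrix ρ B A)ᴴ = covMatrix ρ A B := by
  ext i j
  exact star_trace_mul_mul hρ (hA i) (hB j)

variable [Fintype κ]

theorem trace_mul_sum_mul_sum (ρ : Matrix ι ι ℂ) (Z : κ → Matrix ι ι ℂ) (ξ η : κ → ℂ) :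
    (ρ * (∑ i, ξ i • Z i) * ∑ j, η j • Z j).trace =
      ∑ i, ∑ j, ξ i * η j * covMatrix ρ Z Z j i := by
  simp only [Finset.mul_sum, Finset.sum_mul, Matrix.mul_smul, Matrix.smul_mul, Matrix.trace_sum,
    Matrix.trace_smul, smul_eq_mul, covMatrix, Matrix.of_apply]
  rw [Finset.sum_comm]
  exact Finset.sum_congr rfl fun i _ => Finset.sum_congr rfl fun j _ => by ring

theorem posSemidef_covMatrix {ρ : Matrix ι ι ℂ} (hρ : ρ.PosSemidef) {Z : κ → Matrix ι ι ℂ}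
    (hZ : ∀ i, (Z i).IsHermitian) : (covMatrix ρ Z Z).PosSemidef := by
  refine Matrix.PosSemidef.of_dotProduct_mulVec_nonneg
    (covMatrix_conjTranspose hρ.isHermitian hZ hZ) fun x => ?_
  -- The quadratic form is Tr WρWᴴ with W = ∑ x̄ᵢZᵢ.
  have h : star x ⬝ᵥ (covMatrix ρ Z Z *ᵥ x) =
      ((∑ i, star (x i) • Z i) * ρ * (∑ i, star (x i) • Z i)ᴴ).trace := by
    have hs : (∑ i, star (x i) • Z i)ᴴ = ∑ i, x i • Z i := by
      simp [Matrix.conjTranspose_sum, Matrix.conjTranspose_smul, (hZ _).eq]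
    rw [hs, Matrix.mul_assoc, Matrix.trace_mul_comm, trace_mul_sum_mul_sum, Finset.sum_comm]
    simp only [dotProduct, Matrix.mulVec, Pi.star_apply, Finset.mul_sum]
    exact Finset.sum_congr rfl fun i _ => Finset.sum_congr rfl fun j _ => by ring
  rw [h]
  exact (hρ.mul_mul_conjTranspose_same _).trace_nonneg

theorem gaussianQuasiChar_covMatrix (m : κ → ℝ) (ρ : Matrix ι ι ℂ) (Z : κ → Matrix ι ι ℂ) {s : ℕ}
    (ξ : Fin s → κ → ℂ) :
    gaussianQuasiChar m (covMatrix ρ Z Z) ξ =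
      Complex.exp (∑ t, (Complex.I * ∑ i, ξ t i * (m i : ℂ)
          - 1 / 2 * (ρ * (∑ i, ξ t i • Z i) * ∑ i, ξ t i • Z i).trace)
        - ∑ t, ∑ u ∈ Finset.Ioi t, (ρ * (∑ i, ξ t i • Z i) * ∑ i, ξ u i • Z i).trace) := by
  simp only [gaussianQuasiChar, trace_mul_sum_mul_sum]

variable [DecidableEq ι]

theorem sum_smul_normalizedSum (n : ℕ) (Z : κ → Matrix ι ι ℂ) (ξ : κ → ℂ) :
    ∑ i, ξ i • normalizedSum n (Z i) = normalizedSum n (∑ i, ξ i • Z i) := by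
  simp only [← normalizedSumLin_apply, map_sum, map_smul]

theorem convergesInLaw_normalizedSum {ρ : ℕ → Matrix ι ι ℂ} {ρ₀ : Matrix ι ι ℂ}
    (hρ₀ : ρ₀.PosSemidef) (hρ : Tendsto ρ atTop (𝓝 ρ₀))
    (htr : ∀ᶠ n in atTop, (ρ n).trace = 1) {Z : κ → Matrix ι ι ℂ} (hZ : ∀ i, (Z i).IsHermitian)
    {m : κ → ℝ} (hm : ∀ i, Tendsto (fun n : ℕ => ((Real.sqrt n : ℝ) : ℂ) * (ρ n * Z i).trace) atTop
      (𝓝 (m i : ℂ))) :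
    ConvergesInLaw (fun n i => normalizedSum n (Z i)) (fun n => tensorPow n (ρ n)) m
      (covMatrix ρ₀ Z Z) := by
  refine ⟨posSemidef_covMatrix hρ₀ hZ, fun s ξ => ?_⟩
  simp only [sum_smul_normalizedSum]
  rw [gaussianQuasiChar_covMatrix]
  refine tendsto_trace_tensorPow_exp hρ htr (Y := fun _ t => ∑ i, ξ t i • Z i)
    (Y₀ := fun t => ∑ i, ξ t i • Z i) (c := fun t => ∑ i, ξ t i * (m i : ℂ))
    (fun t => tendsto_const_nhds) fun t => ?_
  refine (tendsto_finsetSum _ fun i _ => (hm i).const_mul (ξ t i)).congr fun n => ?_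
  simp only [Finset.mul_sum, Matrix.mul_smul, Matrix.trace_sum, Matrix.trace_smul, smul_eq_mul]
  exact Finset.sum_congr rfl fun i _ => by ring

end Covariance

/-! ### Log-likelihood ratios along a curve -/

section LikelihoodPaths

variable {ι : Type*} [Fintype ι]

/-- Writing the matrix as a Gram matrix, an off-diagonal entry is bounded by the mean of two
diagonal ones. It lets the trace of the singular part control all of its entries. -/
theorem norm_apply_le_trace [DecidableEq ι] {A : Matrix ι ι ℂ} (hA : A.PosSemidef) (x y : ι) :
    ‖A x y‖ ≤ ‖A.trace‖ := by
  obtain ⟨C, rfl⟩ := posSemidef_exists_factor hA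
  have hd : ∀ x, (Cᴴ * C) x x = ((∑ z, ‖C z x‖ ^ 2 : ℝ) : ℂ) := fun x => by
    simp [Matrix.mul_apply, Complex.conj_mul']
  have ht : ∀ x, ∑ z, ‖C z x‖ ^ 2 ≤ ‖(Cᴴ * C).trace‖ := fun x => by
    have h : (Cᴴ * C).trace = ((∑ x, ∑ z, ‖C z x‖ ^ 2 : ℝ) : ℂ) := by
      simp only [Matrix.trace, Matrix.diag_apply, hd, Complex.ofReal_sum]
    rw [h, Complex.norm_real]
    refine le_trans ?_ (le_abs_self _)
    exact Finset.single_le_sum (f := fun x => ∑ z, ‖C z x‖ ^ 2)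
      (fun _ _ => Finset.sum_nonneg fun _ _ => sq_nonneg _) (Finset.mem_univ x)
  calc ‖(Cᴴ * C) x y‖ ≤ ∑ z, ‖C z x‖ * ‖C z y‖ := by
        rw [Matrix.mul_apply]
        refine (norm_sum_le _ _).trans (le_of_eq (Finset.sum_congr rfl fun z _ => ?_))
        simp
    _ ≤ ∑ z, (‖C z x‖ ^ 2 + ‖C z y‖ ^ 2) / 2 := Finset.sum_le_sum fun z _ => by
        nlinarith [sq_nonneg (‖C z x‖ - ‖C z y‖)]
    _ = (∑ z, ‖C z x‖ ^ 2 + ∑ z, ‖C z y‖ ^ 2) / 2 := by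
        rw [← Finset.sum_div, Finset.sum_add_distrib]
    _ ≤ ‖(Cᴴ * C).trace‖ := by linarith [ht x, ht y]

theorem tendsto_sqrt_smul_of_hasDerivAt {f : ℝ → Matrix ι ι ℂ} {f' : Matrix ι ι ℂ}
    (hf : HasDerivAt f f' 0) :
    Tendsto (fun n : ℕ => ((Real.sqrt n : ℝ) : ℂ) • (f (Real.sqrt n)⁻¹ - f 0)) atTop (𝓝 f') := by
  have h : Tendsto (fun t : ℝ => t⁻¹ • (f (0 + t) - f 0)) (𝓝[≠] 0) (𝓝 f') := by
    open scoped Matrix.Norms.Operator in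
    exact hasDerivAt_iff_tendsto_slope_zero.1 hf
  have hs : Tendsto (fun n : ℕ => (Real.sqrt n)⁻¹) atTop (𝓝[≠] 0) :=
    tendsto_nhdsWithin_iff.2 ⟨tendsto_inv_sqrt_natCast, by
      filter_upwards [eventually_gt_atTop 0] with n hn
      exact inv_ne_zero (Real.sqrt_pos.2 (Nat.cast_pos.2 hn)).ne'⟩
  refine (h.comp hs).congr fun n => ?_
  simp only [Function.comp_apply, inv_inv, zero_add]
  rfl

/-- The difference quotients along 1/√n are eventually Hermitian, and the Hermitian condition is
closed. -/
theorem isHermitian_of_hasDerivAt {L : ℝ → Matrix ι ι ℂ} {A : Matrix ι ι ℂ}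
    (hL : ∀ᶠ t in 𝓝 0, (L t).IsHermitian) (hL0 : L 0 = 0) (hA : HasDerivAt L A 0) :
    A.IsHermitian := by
  have ha : Tendsto (fun n : ℕ => ((Real.sqrt n : ℝ) : ℂ) • L (Real.sqrt n)⁻¹) atTop (𝓝 A) := by
    simpa [hL0] using tendsto_sqrt_smul_of_hasDerivAt hA
  have hstar : Continuous (Matrix.conjTranspose : Matrix ι ι ℂ → Matrix ι ι ℂ) :=
    continuous_id.matrix_conjTranspose
  refine tendsto_nhds_unique (((hstar.tendsto _).comp ha).congr' ?_) ha
  filter_upwards [tendsto_inv_sqrt_natCast.eventually hL] with n hn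
  simp [Matrix.conjTranspose_smul, hn.eq]

variable [DecidableEq ι]

theorem hasDerivAt_exp_half {L : ℝ → Matrix ι ι ℂ} {A : Matrix ι ι ℂ} (hL0 : L 0 = 0)
    (hA : HasDerivAt L A 0) :
    HasDerivAt (fun t => NormedSpace.exp ((1 / 2 : ℂ) • L t)) ((1 / 2 : ℂ) • A) 0 := by
  open scoped Matrix.Norms.Operator in
  have h1 : HasFDerivAt (NormedSpace.exp : Matrix ι ι ℂ → Matrix ι ι ℂ)
      (1 : Matrix ι ι ℂ →L[ℝ] Matrix ι ι ℂ) ((1 / 2 : ℂ) • L 0) := by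
    rw [hL0, smul_zero]
    exact hasFDerivAt_exp_zero
  exact h1.comp_hasDerivAt (0 : ℝ) (hA.const_smul (1 / 2 : ℂ))

/-- A model is differentiable along a curve along which the log-likelihood ratio is, when the
singular part of the model is negligible. -/
theorem hasDerivAt_of_isLogLikelihoodRatio {σ L : ℝ → Matrix ι ι ℂ} {A : Matrix ι ι ℂ}
    (hσ : ∀ᶠ t in 𝓝 0, (σ t).trace = 1)
    (hL : ∀ᶠ t in 𝓝 0, IsLogLikelihoodRatio (L t) (σ t) (σ 0)) (hL0 : L 0 = 0)
    (hA : HasDerivAt L A 0)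
    (htr : (fun t => (σ 0 * NormedSpace.exp (L t)).trace - 1) =o[𝓝 0] fun t : ℝ => t) :
    HasDerivAt σ ((1 / 2 : ℂ) • (σ 0 * A + A * σ 0)) 0 := by
  set E : ℝ → Matrix ι ι ℂ := fun t => NormedSpace.exp ((1 / 2 : ℂ) • L t) with hE
  have hE' : HasDerivAt E ((1 / 2 : ℂ) • A) 0 := hasDerivAt_exp_half hL0 hA
  have hE0 : E 0 = 1 := by simp [hE, hL0, NormedSpace.exp_zero]
  have hprod : HasDerivAt (fun t => E t * σ 0 * E t) ((1 / 2 : ℂ) • (σ 0 * A + A * σ 0)) 0 := by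
    open scoped Matrix.Norms.Operator in
    have h := (hE'.mul_const (σ 0)).mul hE'
    rw [hE0] at h
    have he : (1 / 2 : ℂ) • (σ 0 * A + A * σ 0) =
        (1 / 2 : ℂ) • A * σ 0 * 1 + 1 * σ 0 * ((1 / 2 : ℂ) • A) := by
      rw [Matrix.mul_one, Matrix.one_mul, Matrix.smul_mul, Matrix.mul_smul, smul_add, add_comm]
    rw [he]
    exact h
  -- Near 0 this difference is the singular part, whose entries are bounded by its trace.
  have hrem : HasDerivAt (fun t => σ t - E t * σ 0 * E t) 0 0 := by
    refine hasDerivAt_pi.2 fun x => hasDerivAt_pi.2 fun y => ?_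
    rw [hasDerivAt_iff_isLittleO]
    have h0 : (σ 0 - E 0 * σ 0 * E 0) x y = 0 := by simp [hE0]
    refine Asymptotics.IsBigO.trans_isLittleO (Asymptotics.IsBigO.of_bound 1 ?_)
      (htr.congr_right fun t => (sub_zero t).symm)
    filter_upwards [hσ, hL] with t ht hLt
    obtain ⟨-, σa, σs, hd, he⟩ := hLt
    have hs : σ t - E t * σ 0 * E t = σs := by
      rw [hE]; dsimp only; rw [← he, hd.eq_add, add_sub_cancel_left]
    have hexp : E t * E t = NormedSpace.exp (L t) := by
      rw [hE]; dsimp only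
      rw [← Matrix.exp_add_of_commute _ _ (Commute.refl _), ← add_smul]
      norm_num
    -- By cyclicity Tr EρE = Tr ρe^L, so the deficit is exactly the trace of the singular part.
    have htrs : (σ 0 * NormedSpace.exp (L t)).trace - 1 = -σs.trace := by
      have hcyc : (E t * σ 0 * E t).trace = (σ 0 * NormedSpace.exp (L t)).trace := by
        rw [Matrix.trace_mul_comm, ← Matrix.mul_assoc, hexp, Matrix.trace_mul_comm]
      rw [← hs, Matrix.trace_sub, ht, hcyc]
      ring
    rw [htrs, norm_neg, one_mul]
    have := norm_apply_le_trace hd.posSemidef_sing x y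
    rw [← hs] at this ⊢
    simpa [h0] using this
  open scoped Matrix.Norms.Operator in
  have h := hprod.add hrem
  rw [add_zero] at h
  exact h.congr_of_eventuallyEq (Eventually.of_forall fun t => (add_sub_cancel _ _).symm)

/-- With aₙ = √n L(1/√n), n Tr ρ(e^{L} - 1) → 0 by hypothesis and n Tr ρ(e^{L} - 1 - n^{-1/2}aₙ) → ½
Tr ρA²; subtract. -/
theorem tendsto_sqrt_trace_logLikelihood {ρ : Matrix ι ι ℂ} {L : ℝ → Matrix ι ι ℂ}
    {A : Matrix ι ι ℂ} (hρ : ρ.trace = 1) (hL0 : L 0 = 0) (hA : HasDerivAt L A 0)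
    (htr : (fun t => (ρ * NormedSpace.exp (L t)).trace - 1) =o[𝓝 0] fun t : ℝ => t ^ 2) :
    Tendsto (fun n : ℕ => ((Real.sqrt n : ℝ) : ℂ) *
      (ρ * (((Real.sqrt n : ℝ) : ℂ) • L (Real.sqrt n)⁻¹)).trace) atTop
      (𝓝 (-(1 / 2) * (ρ * A * A).trace)) := by
  have ha : Tendsto (fun n : ℕ => ((Real.sqrt n : ℝ) : ℂ) • L (Real.sqrt n)⁻¹) atTop (𝓝 A) := by
    simpa [hL0] using tendsto_sqrt_smul_of_hasDerivAt hA
  have hexp := (hasExpansion_exp ha).tendsto_snd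
  have htrace : Continuous (Matrix.trace : Matrix ι ι ℂ → ℂ) := continuous_id.matrix_trace
  have h1 := (htrace.tendsto _).comp (hexp.const_mul ρ)
  have h2 : Tendsto (fun n : ℕ => (n : ℂ) *
      ((ρ * NormedSpace.exp (L (Real.sqrt n)⁻¹)).trace - 1)) atTop (𝓝 0) := by
    have h := (htr.comp_tendsto tendsto_inv_sqrt_natCast).tendsto_inv_smul_nhds_zero
    refine h.congr fun n => ?_
    simp
  have h3 := h2.sub h1
  refine (h3.congr' ?_).trans (le_of_eq ?_)
  · filter_upwards [eventually_gt_atTop 0] with n hpos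
    have hne := sqrt_natCast_ne_zero hpos
    simp only [Function.comp_apply, smul_smul, inv_mul_cancel₀ hne, one_smul, Matrix.mul_smul,
      Matrix.mul_sub, Matrix.trace_smul, Matrix.trace_sub, Matrix.mul_one, hρ, smul_eq_mul]
    rw [natCast_eq_sqrt_mul_sqrt n]
    ring
  · simp [Matrix.mul_assoc]

/-- Tr ρaₙ tends to Tr ρA, while √n Tr ρaₙ stays bounded. -/
theorem trace_mul_eq_zero_of_logLikelihood {ρ : Matrix ι ι ℂ} {L : ℝ → Matrix ι ι ℂ}
    {A : Matrix ι ι ℂ} (hρ : ρ.trace = 1) (hL0 : L 0 = 0) (hA : HasDerivAt L A 0)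
    (htr : (fun t => (ρ * NormedSpace.exp (L t)).trace - 1) =o[𝓝 0] fun t : ℝ => t ^ 2) :
    (ρ * A).trace = 0 := by
  have ha : Tendsto (fun n : ℕ => ((Real.sqrt n : ℝ) : ℂ) • L (Real.sqrt n)⁻¹) atTop (𝓝 A) := by
    simpa [hL0] using tendsto_sqrt_smul_of_hasDerivAt hA
  have htrace : Continuous (Matrix.trace : Matrix ι ι ℂ → ℂ) := continuous_id.matrix_trace
  have h1 := (htrace.tendsto _).comp (ha.const_mul ρ)
  have h2 := tendsto_inv_sqrt_natCast_complex.mul (tendsto_sqrt_trace_logLikelihood hρ hL0 hA htr)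
  rw [zero_mul] at h2
  refine tendsto_nhds_unique (h1.congr' ?_) h2
  filter_upwards [eventually_gt_atTop 0] with n hpos
  rw [inv_mul_cancel_left₀ (sqrt_natCast_ne_zero hpos)]
  rfl

/-- Two symmetric logarithmic derivatives differ by an operator that vanishes on the support
of the state. -/
theorem mul_sub_eq_zero_of_anticommutator_eq {ρ A S : Matrix ι ι ℂ} (hρ : ρ.PosSemidef)
    (hA : A.IsHermitian) (hS : S.IsHermitian) (h : ρ * S + S * ρ = ρ * A + A * ρ) :
    ρ * (A - S) = 0 := by
  refine mul_eq_zero_of_conj_eq_zero hρ (hA.sub hS) ?_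
  have h0 : ρ * (A - S) + (A - S) * ρ = 0 := by
    rw [mul_sub, sub_mul, sub_add_sub_comm, h, sub_self]
  -- Multiplying by K = A - S and taking the trace turns both terms into Tr KρK.
  have h1 := congrArg Matrix.trace (congrArg (fun M => (A - S) * M) h0)
  simp only [mul_add, Matrix.trace_add, mul_zero, Matrix.trace_zero, ← Matrix.mul_assoc] at h1
  have h2 : ((A - S) * (A - S) * ρ).trace = ((A - S) * ρ * (A - S)).trace := by
    rw [Matrix.mul_assoc, Matrix.trace_mul_comm]
  rw [h2, ← two_mul] at h1
  simpa using h1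

end LikelihoodPaths

/-! ### Expansion of the log-likelihood ratio of independent copies -/

section LocalAsymptoticNormality

theorem sumElim_normalizedSum {ι : Type*} [DecidableEq ι] {κ κ' : Type*}
    (B : κ → Matrix ι ι ℂ) (S : κ' → Matrix ι ι ℂ) (n : ℕ) :
    Sum.elim (fun i => normalizedSum n (B i)) (fun i => normalizedSum n (S i)) =
      fun i => normalizedSum n (Sum.elim B S i) := by
  ext1 (i | i) <;> rfl

theorem isLittleO_comp_smul {d : ℕ} {f : Param d → ℂ}
    (hf : f =o[𝓝 0] fun h : Param d => ‖h‖ ^ 2) (h : Param d) :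
    (fun t : ℝ => f (t • h)) =o[𝓝 0] fun t : ℝ => t ^ 2 := by
  have ht : Tendsto (fun t : ℝ => t • h) (𝓝 0) (𝓝 0) := by
    have : Continuous fun t : ℝ => t • h := by fun_prop
    simpa using this.tendsto 0
  refine (hf.comp_tendsto ht).trans_isBigO (Asymptotics.IsBigO.of_bound (‖h‖ ^ 2) ?_)
  refine Eventually.of_forall fun t => le_of_eq ?_
  simp [norm_smul, mul_pow, mul_comm]

theorem eventually_add_smul_mem {d : ℕ} {Θ : Set (Param d)} (hΘ : IsOpen Θ) {θ₀ : Param d}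
    (hθ₀ : θ₀ ∈ Θ) (h : Param d) : ∀ᶠ t : ℝ in 𝓝 0, θ₀ + t • h ∈ Θ := by
  have hc : Continuous fun t : ℝ => θ₀ + t • h := by fun_prop
  exact hc.continuousAt.eventually_mem (by simpa using hΘ.mem_nhds hθ₀)

variable {ι : Type*} [Fintype ι]

theorem fromBlocks_covMatrix {κ κ' : Type*} {ρ : Matrix ι ι ℂ} (hρ : ρ.IsHermitian)
    {B : κ → Matrix ι ι ℂ} (hB : ∀ i, (B i).IsHermitian) {S : κ' → Matrix ι ι ℂ}
    (hS : ∀ i, (S i).IsHermitian) :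
    Matrix.fromBlocks (covMatrix ρ B B) (covMatrix ρ B S) (covMatrix ρ B S)ᴴ (covMatrix ρ S S) =
      covMatrix ρ (Sum.elim B S) (Sum.elim B S) := by
  rw [covMatrix_conjTranspose hρ hB hS]
  ext (i | i) (j | j) <;> rfl

theorem hasDerivAt_comp_smul {d : ℕ} {L : Param d → Matrix ι ι ℂ}
    (hL : DifferentiableAt ℝ L 0) (h : Param d) :
    HasDerivAt (fun t : ℝ => L (t • h)) (fderiv ℝ L 0 h) 0 := by
  have hline : HasDerivAt (fun t : ℝ => t • h) h 0 := by
    simpa using (hasDerivAt_id (0 : ℝ)).smul_const h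
  have hL' : HasFDerivAt L (fderiv ℝ L 0) ((0 : ℝ) • h) := by
    rw [zero_smul]
    exact hL.hasFDerivAt
  open scoped Matrix.Norms.Operator in
  exact hL'.comp_hasDerivAt (0 : ℝ) hline

theorem map_eq_sum_smul_single {ι : Type*} {d : ℕ} (A : Param d →L[ℝ] Matrix ι ι ℂ) (h : Param d) :
    A h = ∑ i, (h i : ℂ) • A (EuclideanSpace.single i 1) := by
  have hh : h = ∑ i, h i • EuclideanSpace.single i (1 : ℝ) := by
    ext j
    simp [Pi.single_apply]
  conv_lhs => rw [hh, map_sum]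
  refine Finset.sum_congr rfl fun i _ => ?_
  rw [map_smul]
  rfl

/-- The derivative of an expectation along a curve in terms of a symmetric logarithmic
derivative. -/
theorem trace_half_anticommutator_mul {ρ S B : Matrix ι ι ℂ} (hρ : ρ.IsHermitian)
    (hS : S.IsHermitian) (hB : B.IsHermitian) :
    (((1 / 2 : ℂ) • (ρ * S + S * ρ)) * B).trace = (((ρ * S * B).trace.re : ℝ) : ℂ) := by
  have h : (S * ρ * B).trace = (starRingEnd ℂ) (ρ * S * B).trace := by
    rw [starRingEnd_apply, star_trace_mul_mul hρ hS hB, Matrix.mul_assoc, Matrix.trace_mul_comm]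
  rw [Matrix.smul_mul, Matrix.trace_smul, Matrix.add_mul, Matrix.trace_add, h, Complex.add_conj,
    smul_eq_mul]
  push_cast
  ring

variable [DecidableEq ι]

/-- The remainder, constant included, becomes a normalized sum of one n-dependent observable, to
which the central limit theorem applies. -/
theorem sum_embed_sub_eq_normalizedSum {n : ℕ} (hn : 0 < n) (L S : Matrix ι ι ℂ) (q : ℂ) :
    ∑ k : Fin n, embed k L - (normalizedSum n S - q • 1) =
      normalizedSum n (((Real.sqrt n : ℝ) : ℂ) • L - S + (((Real.sqrt n : ℝ) : ℂ)⁻¹ * q) • 1) := by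
  have hne := sqrt_natCast_ne_zero hn
  have h1 : ∑ k : Fin n, embed k L = ((Real.sqrt n : ℝ) : ℂ) • normalizedSum n L := by
    rw [normalizedSum_eq, smul_smul, mul_inv_cancel₀ hne, one_smul]
  have h2 : (q • 1 : Matrix (Fin n → ι) (Fin n → ι) ℂ) =
      (((Real.sqrt n : ℝ) : ℂ)⁻¹ * q) • normalizedSum n 1 := by
    rw [normalizedSum_one hn, smul_smul, mul_comm _ q, inv_mul_cancel_right₀ hne]
  rw [h1, h2]
  simp only [← normalizedSumLin_apply, map_sub, map_add, map_smul]
  abel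

/-- In the first factor K meets ρ on its left; in the second it meets ρ by cyclicity of the trace.
-/
theorem trace_mul_add_mul_add {ρ K : Matrix ι ι ℂ} (h : ρ * K = 0) (h' : K * ρ = 0)
    (Y Y' : Matrix ι ι ℂ) (η η' : ℂ) :
    (ρ * (Y + η • K) * (Y' + η' • K)).trace = (ρ * Y * Y').trace := by
  have h1 : (ρ * Y * K).trace = 0 := by
    rw [Matrix.trace_mul_comm, ← Matrix.mul_assoc, h', Matrix.zero_mul, Matrix.trace_zero]
  simp [Matrix.mul_add, h, h1]

/-- The remainder in the expansion of the log-likelihood ratio of independent copies along a curve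
is infinitesimal; `S` may be any symmetric logarithmic derivative. -/
theorem isInfinitesimal_logLikelihood {κ : Type*} [Fintype κ] {ρ : Matrix ι ι ℂ}
    (hρ : IsDensity ρ) {Z : κ → Matrix ι ι ℂ} (hZ : ∀ i, (Z i).IsHermitian)
    (hZ0 : ∀ i, (ρ * Z i).trace = 0) {L : ℝ → Matrix ι ι ℂ} {A S : Matrix ι ι ℂ}
    (hL : ∀ᶠ t in 𝓝 0, (L t).IsHermitian) (hL0 : L 0 = 0) (hA : HasDerivAt L A 0)
    (htr : (fun t => (ρ * NormedSpace.exp (L t)).trace - 1) =o[𝓝 0] fun t : ℝ => t ^ 2)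
    (hS : S.IsHermitian) (hK : ρ * (A - S) = 0) :
    IsInfinitesimal (fun n i => normalizedSum n (Z i)) (fun n => tensorPow n ρ)
      (covMatrix ρ Z Z)
      (fun n => ∑ k : Fin n, embed k (L (Real.sqrt n)⁻¹) -
        (normalizedSum n S - (1 / 2 * (ρ * S * S).trace) • 1)) := by
  have hAh : A.IsHermitian := isHermitian_of_hasDerivAt hL hL0 hA
  have hK' : (A - S) * ρ = 0 := by
    have h := congrArg Matrix.conjTranspose hK
    rwa [Matrix.conjTranspose_mul, (hAh.sub hS).eq, hρ.posSemidef.isHermitian.eq,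
      Matrix.conjTranspose_zero] at h
  have hAA : (ρ * A * A).trace = (ρ * S * S).trace := by
    -- A = S + K with K = A - S.
    have h := trace_mul_add_mul_add hK hK' S S 1 1
    simpa using h
  have hA0 := trace_mul_eq_zero_of_logLikelihood hρ.trace_eq_one hL0 hA htr
  have hS0 : (ρ * S).trace = 0 := by
    rw [Matrix.mul_sub, sub_eq_zero] at hK
    rw [← hK, hA0]
  refine ⟨convergesInLaw_normalizedSum hρ.posSemidef tendsto_const_nhds
    (Eventually.of_forall fun _ => hρ.trace_eq_one) hZ fun i => by simp [hZ0 i], ?_, ?_⟩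
  · filter_upwards [tendsto_inv_sqrt_natCast.eventually hL] with n hn
    have hq : star (ρ * S * S).trace = (ρ * S * S).trace :=
      star_trace_mul_mul hρ.posSemidef.isHermitian hS hS
    refine Matrix.IsHermitian.sub ?_ ((isHermitian_normalizedSum hS).sub ?_)
    · rw [Matrix.IsHermitian, Matrix.conjTranspose_sum]
      simp [(isHermitian_embed _ hn).eq]
    · rw [Matrix.IsHermitian, Matrix.conjTranspose_smul, Matrix.conjTranspose_one, star_mul', hq]
      simp
  · intro s ξ η
    set P : ℕ → Matrix ι ι ℂ := fun n => ((Real.sqrt n : ℝ) : ℂ) • L (Real.sqrt n)⁻¹ - S +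
      (((Real.sqrt n : ℝ) : ℂ)⁻¹ * (1 / 2 * (ρ * S * S).trace)) • 1 with hP
    have hPlim : Tendsto P atTop (𝓝 (A - S)) := by
      have ha : Tendsto (fun n : ℕ => ((Real.sqrt n : ℝ) : ℂ) • L (Real.sqrt n)⁻¹) atTop (𝓝 A) := by
        simpa [hL0] using tendsto_sqrt_smul_of_hasDerivAt hA
      have h := (ha.sub_const S).add ((tendsto_inv_sqrt_natCast_complex.mul_const
        (1 / 2 * (ρ * S * S).trace)).smul_const (1 : Matrix ι ι ℂ))
      rwa [zero_mul, zero_smul, add_zero] at h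
    -- The limit -½ Tr ρA² from the log-likelihood cancels the constant ½ Tr ρS².
    have hPtr : Tendsto (fun n : ℕ => ((Real.sqrt n : ℝ) : ℂ) * (ρ * P n).trace) atTop (𝓝 0) := by
      have h := (tendsto_sqrt_trace_logLikelihood hρ.trace_eq_one hL0 hA htr).add_const
        (1 / 2 * (ρ * S * S).trace)
      rw [hAA, neg_mul, neg_add_cancel] at h
      refine h.congr' ?_
      filter_upwards [eventually_gt_atTop 0] with n hn
      rw [hP]
      simp only [Matrix.mul_sub, Matrix.trace_add, Matrix.trace_sub, hS0, sub_zero,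
        Matrix.mul_smul ρ _ (1 : Matrix ι ι ℂ), Matrix.trace_smul, hρ.trace_eq_one, smul_eq_mul,
        mul_one, mul_add]
      rw [mul_inv_cancel_left₀ (sqrt_natCast_ne_zero hn)]
    have hmain := tendsto_trace_tensorPow_exp (ρ := fun _ => ρ) (ρ₀ := ρ) tendsto_const_nhds
      (Eventually.of_forall fun _ => hρ.trace_eq_one)
      (Y := fun n t => ∑ i, ξ t i • Z i + η t • P n)
      (Y₀ := fun t => ∑ i, ξ t i • Z i + η t • (A - S)) (c := fun _ => 0)
      (fun t => tendsto_const_nhds.add (hPlim.const_smul (η t))) (fun t => by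
        have h := hPtr.const_mul (η t)
        rw [mul_zero] at h
        refine h.congr fun n => ?_
        simp only [Matrix.mul_add, Matrix.mul_sum, Matrix.mul_smul, Matrix.trace_add,
          Matrix.trace_sum, Matrix.trace_smul, hZ0, smul_eq_mul, mul_zero, Finset.sum_const_zero,
          zero_add]
        ring)
    simp only [trace_mul_add_mul_add hK hK'] at hmain
    have hg := gaussianQuasiChar_covMatrix (0 : κ → ℝ) ρ Z ξ
    simp only [Pi.zero_apply, Complex.ofReal_zero, mul_zero, Finset.sum_const_zero] at hg
    simp only [mul_zero] at hmain
    rw [hg]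
    refine hmain.congr' ?_
    filter_upwards [eventually_gt_atTop 0] with n hn
    simp only [sum_embed_sub_eq_normalizedSum hn, sum_smul_normalizedSum]
    simp only [← normalizedSumLin_apply, map_add, map_smul, hP]

end LocalAsymptoticNormality

end QLAN

end

/-! ### The main theorem -/

theorem mainTheorem4 {ι : Type*} [Fintype ι] [DecidableEq ι] {d r : ℕ}
    (Θ : Set (QLAN.Param d)) (ρ : QLAN.Param d → Matrix ι ι ℂ) (hρ : QLAN.IsModel Θ ρ)
    (θ₀ : QLAN.Param d) (hθ₀ : θ₀ ∈ Θ)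
    (hac : ∀ θ ∈ Θ, QLAN.AbsCont (ρ θ₀) (ρ θ))
    (B : Fin r → Matrix ι ι ℂ) (hB : ∀ i, (B i).IsHermitian)
    (hB0 : ∀ i, (ρ θ₀ * B i).trace = 0)
    (L : QLAN.Param d → Matrix ι ι ℂ)
    (hL : ∀ h, θ₀ + h ∈ Θ → QLAN.IsLogLikelihoodRatio (L h) (ρ (θ₀ + h)) (ρ θ₀))
    (hL0 : L 0 = 0)
    (hdiff : DifferentiableAt ℝ L 0)
    (htr : (fun h => (ρ θ₀ * NormedSpace.exp (L h)).trace - 1) =o[𝓝 0]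
      fun h : QLAN.Param d => ‖h‖ ^ 2) :
    (∃ S : Fin d → Matrix ι ι ℂ, ∀ i, QLAN.IsSLD ρ θ₀ i (S i)) ∧
    ∀ S : Fin d → Matrix ι ι ℂ, (∀ i, QLAN.IsSLD ρ θ₀ i (S i)) →
      (((QLAN.covMatrix (ρ θ₀) S S).map Complex.re).PosDef →
        QLAN.IsJointlyQLAN Θ (fun n θ => QLAN.tensorPow n (ρ θ)) θ₀
          (fun n i => QLAN.normalizedSum n (B i))
          (fun n i => QLAN.normalizedSum n (S i))
          (QLAN.covMatrix (ρ θ₀) B B) (QLAN.covMatrix (ρ θ₀) B S)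
          (QLAN.covMatrix (ρ θ₀) S S)) ∧
      ∀ h : QLAN.Param d,
        QLAN.ConvergesInLaw (fun n i => QLAN.normalizedSum n (B i))
          (fun n => QLAN.tensorPow n (ρ (θ₀ + (Real.sqrt n)⁻¹ • h)))
          (((QLAN.covMatrix (ρ θ₀) B S).map Complex.re).mulVec h)
          (QLAN.covMatrix (ρ θ₀) B B) := by
  have hρ₀ := hρ.isDensity θ₀ hθ₀
  have hρh := hρ₀.posSemidef.isHermitian
  have hmem := QLAN.eventually_add_smul_mem hρ.isOpen hθ₀
  have hLz : ∀ h : QLAN.Param d, L ((0 : ℝ) • h) = 0 := fun h => by rw [zero_smul, hL0]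
  have hLd := QLAN.hasDerivAt_comp_smul hdiff
  have hLh : ∀ h : QLAN.Param d, ∀ᶠ t : ℝ in 𝓝 0, (L (t • h)).IsHermitian := fun h => by
    filter_upwards [hmem h] with t ht using (hL _ ht).1
  have htr' := QLAN.isLittleO_comp_smul htr
  set A := fderiv ℝ L 0
  have hAh : ∀ h, (A h).IsHermitian := fun h =>
    QLAN.isHermitian_of_hasDerivAt (hLh h) (hLz h) (hLd h)
  have hρd : ∀ h : QLAN.Param d, HasDerivAt (fun t : ℝ => ρ (θ₀ + t • h))
      ((1 / 2 : ℂ) • (ρ θ₀ * A h + A h * ρ θ₀)) 0 := fun h => by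
    have h0 : ρ (θ₀ + (0 : ℝ) • h) = ρ θ₀ := by rw [zero_smul, add_zero]
    have hd := QLAN.hasDerivAt_of_isLogLikelihoodRatio (σ := fun t : ℝ => ρ (θ₀ + t • h))
      (L := fun t : ℝ => L (t • h)) (A := A h)
      (by filter_upwards [hmem h] with t ht using (hρ.isDensity _ ht).trace_eq_one)
      (by filter_upwards [hmem h] with t ht; rw [h0]; exact hL _ ht) (hLz h) (hLd h)
      (by
        simp only [h0]
        exact (htr' h).trans (Asymptotics.isLittleO_pow_id one_lt_two))
    simpa only [h0] using hd
  refine ⟨⟨fun i => A (EuclideanSpace.single i 1), fun i => ⟨hAh _, hρd _⟩⟩, fun S hS => ?_⟩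
  have hSh : ∀ i, (S i).IsHermitian := fun i => (hS i).1
  have hanti : ∀ i, ρ θ₀ * S i + S i * ρ θ₀ =
      ρ θ₀ * A (EuclideanSpace.single i 1) + A (EuclideanSpace.single i 1) * ρ θ₀ := fun i => by
    have hu : (1 / 2 : ℂ) • (ρ θ₀ * S i + S i * ρ θ₀) = (1 / 2 : ℂ) •
        (ρ θ₀ * A (EuclideanSpace.single i 1) + A (EuclideanSpace.single i 1) * ρ θ₀) := by
      open scoped Matrix.Norms.Operator in
      exact (hS i).2.unique (hρd (EuclideanSpace.single i 1))
    exact smul_right_injective _ (by norm_num : (1 / 2 : ℂ) ≠ 0) hu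
  -- An arbitrary symmetric logarithmic derivative agrees with the derivative of L after
  -- multiplication by ρ, so it may replace that derivative in every moment below.
  have hK₁ : ∀ i, ρ θ₀ * A (EuclideanSpace.single i 1) = ρ θ₀ * S i := fun i => by
    have h := QLAN.mul_sub_eq_zero_of_anticommutator_eq hρ₀.posSemidef (hAh _) (hSh i) (hanti i)
    rwa [Matrix.mul_sub, sub_eq_zero] at h
  have hK : ∀ h : QLAN.Param d, ρ θ₀ * (A h - ∑ i, (h i : ℂ) • S i) = 0 := fun h => by
    rw [Matrix.mul_sub, sub_eq_zero, QLAN.map_eq_sum_smul_single, Matrix.mul_sum, Matrix.mul_sum]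
    exact Finset.sum_congr rfl fun i _ => by rw [Matrix.mul_smul, Matrix.mul_smul, hK₁ i]
  have hSsum : ∀ h : QLAN.Param d, (∑ i, (h i : ℂ) • S i).IsHermitian := fun h => by
    rw [Matrix.IsHermitian, Matrix.conjTranspose_sum]
    simp [(hSh _).eq]
  have hS0 : ∀ i, (ρ θ₀ * S i).trace = 0 := fun i => by
    rw [← hK₁ i]
    exact QLAN.trace_mul_eq_zero_of_logLikelihood hρ₀.trace_eq_one (hLz _) (hLd _) (htr' _)
  refine ⟨fun hJ => ?_, fun h => ?_⟩
  · have hZ : ∀ i, (Sum.elim B S i).IsHermitian := by rintro (i | i) <;> simp [hB, hSh]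
    have hZ0 : ∀ i, (ρ θ₀ * Sum.elim B S i).trace = 0 := by rintro (i | i) <;> simp [hB0, hS0]
    refine
      { isModel := fun n _ => ⟨hρ.isOpen, fun θ hθ => QLAN.isDensity_tensorPow (hρ.isDensity θ hθ)⟩
        mem := hθ₀
        isHermitian_X := fun n _ i => QLAN.isHermitian_normalizedSum (hB i)
        absCont := fun n _ θ hθ => QLAN.absCont_tensorPow hρ₀.posSemidef
          (hρ.isDensity θ hθ).posSemidef (hac θ hθ)
        isHermitian_Δ := fun n _ i => QLAN.isHermitian_normalizedSum (hSh i)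
        posSemidef_C := QLAN.posSemidef_covMatrix hρ₀.posSemidef hB
        posSemidef_J := QLAN.posSemidef_covMatrix hρ₀.posSemidef hSh
        posDef_re_J := hJ
        convergesInLaw := ?_
        expansion := fun h => ⟨fun n => ∑ k : Fin n, QLAN.embed k (L ((Real.sqrt n)⁻¹ • h)),
          fun n _ hn => QLAN.isLogLikelihoodRatio_tensorPow hρ₀.posSemidef (hL _ hn), ?_⟩ }
    · simp only [QLAN.sumElim_normalizedSum, QLAN.fromBlocks_covMatrix hρh hB hSh]
      exact QLAN.convergesInLaw_normalizedSum hρ₀.posSemidef tendsto_const_nhds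
        (Eventually.of_forall fun _ => hρ₀.trace_eq_one) hZ fun i => by simp [hZ0 i]
    -- The definition pairs hᵢhⱼ with Jᵢⱼ and the trace formula with Jⱼᵢ; exchanging the two sums
    -- reconciles them.
    · have hq : ∑ i, ∑ j, QLAN.covMatrix (ρ θ₀) S S i j * (h i : ℂ) * (h j : ℂ) =
          (ρ θ₀ * (∑ i, (h i : ℂ) • S i) * ∑ i, (h i : ℂ) • S i).trace := by
        rw [QLAN.trace_mul_sum_mul_sum, Finset.sum_comm]
        exact Finset.sum_congr rfl fun i _ => Finset.sum_congr rfl fun j _ => by ring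
      simp only [QLAN.sumElim_normalizedSum, QLAN.fromBlocks_covMatrix hρh hB hSh, hq,
        QLAN.sum_smul_normalizedSum]
      exact QLAN.isInfinitesimal_logLikelihood hρ₀ hZ hZ0 (L := fun t : ℝ => L (t • h)) (hLh h)
        (hLz h) (hLd h) (htr' h) (hSsum h) (hK h)
  · have hlim := QLAN.tendsto_sqrt_smul_of_hasDerivAt (hρd h)
    have hcont : Tendsto (fun n : ℕ => ρ (θ₀ + (Real.sqrt n)⁻¹ • h)) atTop (𝓝 (ρ θ₀)) := by
      have hc : ContinuousAt (fun t : ℝ => ρ (θ₀ + t • h)) 0 := by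
        open scoped Matrix.Norms.Operator in
        exact (hρd h).continuousAt
      simpa [Function.comp_def] using hc.tendsto.comp QLAN.tendsto_inv_sqrt_natCast
    refine QLAN.convergesInLaw_normalizedSum hρ₀.posSemidef hcont ?_ hB fun i => ?_
    · filter_upwards [QLAN.tendsto_inv_sqrt_natCast.eventually (hmem h)] with n hn
        using (hρ.isDensity _ hn).trace_eq_one
    · have htrace : Continuous (Matrix.trace : Matrix ι ι ℂ → ℂ) := continuous_id.matrix_trace
      have h1 := (htrace.tendsto _).comp (hlim.mul_const (B i))
      -- A h and ∑ hᵢSᵢ agree after multiplication by ρ on either side, so the derivative of the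
      -- state can be written with the given S.
      have h2 : ρ θ₀ * A h + A h * ρ θ₀ =
          ρ θ₀ * (∑ i, (h i : ℂ) • S i) + (∑ i, (h i : ℂ) • S i) * ρ θ₀ := by
        have e1 := hK h
        have e2 := congrArg Matrix.conjTranspose e1
        rw [Matrix.conjTranspose_mul, ((hAh h).sub (hSsum h)).eq, hρh.eq,
          Matrix.conjTranspose_zero, Matrix.sub_mul, sub_eq_zero] at e2
        rw [Matrix.mul_sub, sub_eq_zero] at e1
        rw [e1, e2]
      rw [h2, QLAN.trace_half_anticommutator_mul hρh (hSsum h) (hB i)] at h1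
      have h3 : (ρ θ₀ * (∑ j, (h j : ℂ) • S j) * B i).trace.re =
          ((QLAN.covMatrix (ρ θ₀) B S).map Complex.re).mulVec h i := by
        simp only [Matrix.mul_sum, Matrix.sum_mul, Matrix.mul_smul, Matrix.smul_mul,
          Matrix.trace_sum, Matrix.trace_smul, smul_eq_mul, Complex.re_sum, Complex.re_ofReal_mul,
          Matrix.mulVec, dotProduct, Matrix.map_apply, QLAN.covMatrix, Matrix.of_apply]
        exact Finset.sum_congr rfl fun j _ => mul_comm _ _
      rw [h3] at h1
      -- As Tr ρ₀Bᵢ = 0, the scaled difference of expectations is √n Tr ρₙBᵢ itself.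
      refine h1.congr fun n => ?_
      simp [Matrix.sub_mul, hB0 i]
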